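/- Let $d\ge 1$ and $k\ge 1$ be integers, $1\le p\le\infty$, $\delta>0$, and let $C_a,C_b,C_c,C_d,C_e$ and $C_0>0$ be real constants. Let $\mathcal F$ be the class of all probability densities $f:\mathbb R^d\to[0,\infty)$ such that (a) $f(x)\le C_a$ for almost every $x$; (b) there is $\gamma>0$ with $\int f(x)\,|\log f(x)|^{1+\gamma}\,dx\le C_b$ (the integrand being $0$ where $f=0$); (c) $\int f(x)e^{-b f(x)}\,dx\le C_c\,e^{-C_0 b}$ for all $b>1$; (d) for almost every $x$, $f$ is twice continuously differentiable in a neighbourhood of $x$ and its Hessian satisfies $\|H_f(x)\|_2<C_d$ (spectral norm); (e) the set of points $x$ at which the property in (d) fails has $(d-1)$-dimensional Hausdorff measure less than $C_e$, where $\mathcal H^{d-1}(S)=\lim_{\epsilon\to0}\inf\{\sum_i(\operatorname{diam}U_i)^{d-1}:\ S\subseteq\bigcup_i U_i,\ \operatorname{diam}U_i<\epsilon\}$. For samples $X_1,\dots,X_N\in\mathbb R^d$ let $\rho_{k,i,p}$ be the $\ell_p$ distance from $X_i$ to its $k$-th nearest neighbour among the other samples, let $a_N=\left((\log N)^{1+\delta}/N\right)^{1/d}$,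 let $c_{d,p}$ be the Lebesgue volume of the unit $\ell_p$ ball of $\mathbb R^d$, let $\psi=\Gamma'/\Gamma$ be the digamma function, and put $$\xi_{k,i,p}=\begin{cases}-\psi(k)+\log N+\log c_{d,p}+d\log\rho_{k,i,p},&\rho_{k,i,p}\le a_N,\\ 0,&\rho_{k,i,p}>a_N,\end{cases}\qquad \widehat H_{\rm tKL}=\frac1N\sum_{i=1}^N\xi_{k,i,p}.$$ Then there are constants $C>0$ and $N_0$, depending only on $d,k,p,\delta,C_a,C_b,C_c,C_d,C_e,C_0$, such that for every $f\in\mathcal F$ the entropy $H(f)=-\int f\log f$ is well defined (the integral converges absolutely), and for every $N\ge N_0$, if $X_1,\dots,X_N$ are independent random vectors with density $f$, then $\widehat H_{\rm tKL}$ is integrable and $$\left|\mathbb E\big[\widehat H_{\rm tKL}\big]-H(f)\right|\ \le\ C\,\frac{(\log N)^{(1+\delta)(1+1/d)}}{N^{1/d}}.$$ -/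

import Mathlib

open MeasureTheory ProbabilityTheory
open scoped ENNReal

noncomputable section

namespace KLEntropy

/-- `f` is a probability density function on `ℝᵈ` with respect to Lebesgue measure. -/
structure IsDensity {d : ℕ} (f : EuclideanSpace ℝ (Fin d) → ℝ) : Prop where
  measurable : Measurable f
  nonneg : ∀ x, 0 ≤ f x
  integrable : Integrable f volume
  integral_eq_one : ∫ x, f x = 1

/-- `f` is twice continuously differentiable at (i.e. in a neighbourhood of) `x` and the Hessian
at `x` has spectral norm `< Cd`. The operator norm `sup |D²f(x)(u, v)|` over unit vectors `u, v` of
the Euclidean space is the spectral norm of the Hessian matrix. -/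
def HessianBoundAt {d : ℕ} (f : EuclideanSpace ℝ (Fin d) → ℝ) (Cd : ℝ)
    (x : EuclideanSpace ℝ (Fin d)) : Prop :=
  ContDiffAt ℝ 2 f x ∧ ‖iteratedFDeriv ℝ 2 f x‖ < Cd

/-- The regularity conditions on the density `f`, with constants `Ca, Cb, Cc, Cd, Ce, C0`. -/
structure RegularDensity {d : ℕ} (f : EuclideanSpace ℝ (Fin d) → ℝ)
    (Ca Cb Cc Cd Ce C0 : ℝ) : Prop where
  bounded : ∀ᵐ x, f x ≤ Ca
  log_moment : ∃ γ : ℝ, 0 < γ ∧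
    Integrable (fun x => f x * |Real.log (f x)| ^ (1 + γ)) volume ∧
    ∫ x, f x * |Real.log (f x)| ^ (1 + γ) ≤ Cb
  tail : ∀ b : ℝ, 1 < b → ∫ x, f x * Real.exp (-b * f x) ≤ Cc * Real.exp (-C0 * b)
  hessian : ∀ᵐ x, HessianBoundAt f Cd x
  hausdorff : Measure.hausdorffMeasure ((d : ℝ) - 1) {x | ¬ HessianBoundAt f Cd x} <
    ENNReal.ofReal Ce

/-- The differential entropy `-∫ f log f` of a density. -/
def entropy {d : ℕ} (f : EuclideanSpace ℝ (Fin d) → ℝ) : ℝ :=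
  -∫ x, f x * Real.log (f x)

/-- The `ℓ_p` norm on `ℝᵈ`, `1 ≤ p ≤ ∞`. -/
def pNorm {d : ℕ} (p : ℝ≥0∞) [Fact (1 ≤ p)] (x : EuclideanSpace ℝ (Fin d)) : ℝ :=
  ‖(WithLp.toLp p (WithLp.ofLp x) : PiLp p (fun _ : Fin d => ℝ))‖

/-- The Lebesgue volume of the unit `ℓ_p` ball in `ℝᵈ`. -/
def unitBallVolume (d : ℕ) (p : ℝ≥0∞) [Fact (1 ≤ p)] : ℝ :=
  (volume {x : EuclideanSpace ℝ (Fin d) | pNorm p x ≤ 1}).toReal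

/-- The digamma function `Γ'(x) / Γ(x)` on the positive reals. -/
def digamma (x : ℝ) : ℝ := logDeriv Real.Gamma x

/-- The `ℓ_p` distance from the `i`-th sample to its `k`-th nearest neighbour among the other
samples: the least `r` such that at least `k` of the other samples are within distance `r`
(meaningful when there are more than `k` samples). -/
def knnDist {d N : ℕ} (p : ℝ≥0∞) [Fact (1 ≤ p)] (k : ℕ)
    (x : Fin N → EuclideanSpace ℝ (Fin d)) (i : Fin N) : ℝ :=
  sInf {r : ℝ | 0 ≤ r ∧ k ≤ Set.ncard {j : Fin N | j ≠ i ∧ pNorm p (x j - x i) ≤ r}}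

/-- The truncation threshold `a_N = ((log N)^(1+δ) / N)^(1/d)`. -/
def threshold (d N : ℕ) (δ : ℝ) : ℝ :=
  (Real.log N ^ (1 + δ) / N) ^ (1 / (d : ℝ))

/-- The local estimate at the `i`-th sample, set to `0` if the `k`-th nearest neighbour is farther
away than the truncation threshold. -/
def localEstimate {d N : ℕ} (p : ℝ≥0∞) [Fact (1 ≤ p)] (k : ℕ) (δ : ℝ)
    (x : Fin N → EuclideanSpace ℝ (Fin d)) (i : Fin N) : ℝ :=
  if knnDist p k x i ≤ threshold d N δ then
    -digamma k + Real.log N + Real.log (unitBallVolume d p) + d * Real.log (knnDist p k x i)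
  else 0

/-- The truncated Kozachenko–Leonenko entropy estimator, as a function of the `N` samples. -/
def truncatedKL {d N : ℕ} (p : ℝ≥0∞) [Fact (1 ≤ p)] (k : ℕ) (δ : ℝ)
    (x : Fin N → EuclideanSpace ℝ (Fin d)) : ℝ :=
  (1 / (N : ℝ)) * ∑ i, localEstimate p k δ x i

end KLEntropy

end

/-! Write `N = M + 1`, `a` for the truncation radius, `c` for the volume of the unit ball, and
`F(r)` for the probability that the `k`-th neighbour distance of a given sample is at most `r`. The
layer-cake formula gives every local estimate the mean `B F(a) - d ∫₀ᵃ F(r)/r dr`, with `B` the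
value of the estimate at distance `a`. Conditioning on the sample, `F(r)` is the mean over `x` of
the binomial tail `T(P(ball(x, r)))`, so the problem is to replace the ball mass by `f(x) c r^d`.

This replacement costs `O(r^(d+1))` in mean. By symmetry of the ball the error is an average of
second differences of `f`. These are `O(‖v‖²)` unless the segment `[x - v, x + v]` meets the
exceptional set, and bounded otherwise; the segments that meet it have centres in a set of volume
`O(‖v‖)`, by a covering argument from the Hausdorff bound (`volume_sweep_le`,
`exists_ball_error_le`). As `T` is `M`-Lipschitz, the integral of `F(r)/r` changes by `O(N
a^(d+1))`, which is the claimed rate.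

For the idealised masses the integral is exact: it equals `G(f(x) c a^d)`, where `G' = T(u)/u` and
`G(1) = H_M - H_(k-1)` (harmonic numbers). Since `T` is nearly `1` beyond `C0 c a^d / 2`, `G(w)` is
nearly `G(1) + log w`. The logarithm yields the entropy, while the harmonic numbers cancel against
`ψ(k) = H_(k-1) - γ` and `log N` up to `1/M` (`abs_bias_le`, `bias_terms_le`).

What makes all this uniform is that the tail condition, as `b → ∞`, forces `f ≥ C0` almost
everywhere on the support (`RegularDensity.le_ae`). Hence `log f` is bounded there, the entropy
converges, and every point of the support sees `k` neighbours within `a` except with small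
probability. -/

namespace KLEntropy

/-! ### Segments meeting the exceptional set, and second differences -/

/-- The set swept by a set `U` along the segment `[-v, v]`. -/
def sweep {d : ℕ} (U : Set (EuclideanSpace ℝ (Fin d))) (v : EuclideanSpace ℝ (Fin d)) :
    Set (EuclideanSpace ℝ (Fin d)) :=
  {x | ∃ t ∈ Set.Icc (-1 : ℝ) 1, x + t • v ∈ U}

/-- In an orthonormal basis containing `v/‖v‖`, the swept set lies in a box centred at a point of
`U`. Its half-width is `2‖v‖` along `v` (the shift plus a diameter of at most `‖v‖`) and the
diameter of `U` in the other `d - 1` directions. -/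
lemma volume_sweep_le_of_ediam_le {d : ℕ} (hd : 1 ≤ d) {U : Set (EuclideanSpace ℝ (Fin d))}
    {v : EuclideanSpace ℝ (Fin d)} (hv : v ≠ 0) (hU : U.Nonempty)
    (hUv : Metric.ediam U ≤ ENNReal.ofReal ‖v‖) :
    volume (sweep U v) ≤ ENNReal.ofReal (4 * ‖v‖) * (2 * Metric.ediam U) ^ (d - 1) := by
  have hv0 : 0 < ‖v‖ := norm_pos_iff.2 hv
  obtain ⟨u, hu⟩ := hU
  set i₀ : Fin d := ⟨0, hd⟩
  have hon : Orthonormal ℝ (({i₀} : Set (Fin d)).domRestrict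
      (fun _ : Fin d => (‖v‖⁻¹ : ℝ) • v)) := by
    constructor
    · intro i
      simp [Set.domRestrict, norm_smul, hv0.ne']
    · intro i j hij
      exact absurd (Subsingleton.elim i j) hij
  obtain ⟨b, hb⟩ := hon.exists_orthonormalBasis_extension_of_card_eq (by simp)
  have hb0 : b i₀ = (‖v‖⁻¹ : ℝ) • v := hb i₀ rfl
  have hfin : Metric.ediam U ≠ ∞ := (hUv.trans_lt ENNReal.ofReal_lt_top).ne
  set D := (Metric.ediam U).toReal with hD
  have hD0 : 0 ≤ D := ENNReal.toReal_nonneg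
  have hDv : D ≤ ‖v‖ := ENNReal.toReal_le_of_le_ofReal hv0.le hUv
  have hDU : Metric.ediam U = ENNReal.ofReal D := (ENNReal.ofReal_toReal hfin).symm
  set w : Fin d → ℝ := fun i => if i = i₀ then 2 * ‖v‖ else D with hw
  have hsub : sweep U v ⊆ b.repr ⁻¹' (WithLp.ofLp ⁻¹'
      (Set.univ.pi fun i => Set.Icc (b.repr u i - w i) (b.repr u i + w i))) := by
    rintro x ⟨t, ht, hxt⟩
    have hdist : ‖x + t • v - u‖ ≤ D := by
      rw [← dist_eq_norm, dist_edist]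
      exact ENNReal.toReal_mono hfin (Metric.edist_le_ediam_of_mem hxt hu)
    have hcoord : ∀ i, |b.repr (x + t • v - u) i| ≤ D := fun i => by
      rw [b.repr_apply_apply]
      refine (abs_real_inner_le_norm _ _).trans ?_
      rw [b.orthonormal.1 i, one_mul]; exact hdist
    simp only [Set.mem_preimage, Set.mem_univ_pi]
    intro i
    have h1 := hcoord i
    have hexp : b.repr (x + t • v - u) i = b.repr x i + t * b.repr v i - b.repr u i := by
      simp
    rw [hexp] at h1
    have h2 : |t * b.repr v i| ≤ w i - D := by
      by_cases hi : i = i₀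
      · subst hi
        have : b.repr v i₀ = ‖v‖ := by
          rw [b.repr_apply_apply, hb0, real_inner_smul_left, real_inner_self_eq_norm_sq]
          field_simp
        rw [this, abs_mul, abs_of_pos hv0]
        have : |t| ≤ 1 := abs_le.2 ht
        simp only [hw, if_true]
        nlinarith
      · have : b.repr v i = 0 := by
          have h3 : inner ℝ (b i) (b i₀) = 0 := b.orthonormal.2 hi
          rw [hb0, real_inner_smul_right] at h3
          rw [b.repr_apply_apply]
          exact (mul_eq_zero.1 h3).resolve_left (inv_ne_zero hv0.ne')
        simp [this, hw, hi]
    rw [abs_le] at h1 h2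
    constructor <;> linarith [h1.1, h1.2, h2.1, h2.2]
  refine (measure_mono hsub).trans ?_
  have hbox : MeasurableSet
      (Set.univ.pi fun i => Set.Icc (b.repr u i - w i) (b.repr u i + w i)) :=
    MeasurableSet.univ_pi fun i => measurableSet_Icc
  have hofLp := PiLp.volume_preserving_ofLp (Fin d)
  rw [b.measurePreserving_repr.measure_preimage (hofLp.measurable hbox).nullMeasurableSet,
    hofLp.measure_preimage hbox.nullMeasurableSet, volume_pi_pi]
  simp only [Real.volume_Icc]
  have hprod : ∀ i : Fin d, ENNReal.ofReal (b.repr u i + w i - (b.repr u i - w i)) =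
      if i = i₀ then ENNReal.ofReal (4 * ‖v‖) else 2 * Metric.ediam U := by
    intro i
    have : b.repr u i + w i - (b.repr u i - w i) = 2 * w i := by ring
    rw [this]
    by_cases hi : i = i₀
    · simp only [hw, hi, if_true]; congr 1; ring
    · simp only [hw, hi, if_false]
      rw [ENNReal.ofReal_mul (by norm_num), hDU]; simp
  rw [Finset.prod_congr rfl fun i _ => hprod i, ← Finset.mul_prod_erase _ _ (Finset.mem_univ i₀),
    if_pos rfl]
  gcongr
  rw [Finset.prod_congr rfl (g := fun _ => 2 * Metric.ediam U)
    (fun i hi => if_neg (Finset.ne_of_mem_erase hi)), Finset.prod_const,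
    Finset.card_erase_of_mem (Finset.mem_univ _)]
  simp

/-- The Hausdorff premeasure at scale `‖v‖` is at most the Hausdorff measure, so `S` has a cover by
sets of diameter at most `‖v‖` whose `(d-1)`-sum stays below `c`. The box bound applies to each
piece, and the factor `‖v‖` comes out of the sum. -/
lemma volume_sweep_le {d : ℕ} (hd : 1 ≤ d) {S : Set (EuclideanSpace ℝ (Fin d))} {c : ℝ≥0∞}
    (hS : Measure.hausdorffMeasure ((d : ℝ) - 1) S < c) {v : EuclideanSpace ℝ (Fin d)}
    (hv : v ≠ 0) :
    volume (sweep S v) ≤ ENNReal.ofReal (4 * ‖v‖) * 2 ^ (d - 1) * c := by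
  have hv0 : 0 < ‖v‖ := norm_pos_iff.2 hv
  rw [Measure.hausdorffMeasure_apply] at hS
  have h1 := (le_iSup₂ (f := fun (r : ℝ≥0∞) (_ : 0 < r) =>
      ⨅ (t : ℕ → Set (EuclideanSpace ℝ (Fin d))) (_ : S ⊆ ⋃ n, t n)
        (_ : ∀ n, Metric.ediam (t n) ≤ r),
        ∑' n, ⨆ (_ : (t n).Nonempty), Metric.ediam (t n) ^ ((d : ℝ) - 1))
      (ENNReal.ofReal ‖v‖) (by simpa using hv0)).trans_lt hS
  simp only [iInf_lt_iff] at h1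
  obtain ⟨t, hSt, htd, hsum⟩ := h1
  have hsub : sweep S v ⊆ ⋃ n, sweep (t n) v := by
    rintro x ⟨s, hs, hx⟩
    obtain ⟨n, hn⟩ := Set.mem_iUnion.1 (hSt hx)
    exact Set.mem_iUnion.2 ⟨n, s, hs, hn⟩
  calc volume (sweep S v) ≤ ∑' n, volume (sweep (t n) v) :=
        (measure_mono hsub).trans (measure_iUnion_le _)
    _ ≤ ∑' n, ENNReal.ofReal (4 * ‖v‖) * 2 ^ (d - 1) *
          ⨆ (_ : (t n).Nonempty), Metric.ediam (t n) ^ ((d : ℝ) - 1) := by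
        refine ENNReal.tsum_le_tsum fun n => ?_
        by_cases hn : (t n).Nonempty
        · refine (volume_sweep_le_of_ediam_le hd hv hn (htd n)).trans ?_
          simp only [hn, ciSup_unique]
          rw [mul_pow, ← mul_assoc, ← ENNReal.rpow_natCast (Metric.ediam (t n)),
            Nat.cast_sub hd, Nat.cast_one]
        · have : sweep (t n) v = ∅ := by
            rw [Set.not_nonempty_iff_eq_empty.1 hn]; ext x; simp [sweep]
          simp [this]
    _ ≤ _ := by
        rw [ENNReal.tsum_mul_left]
        gcongr

/-- The whole segment consists of good points, so the mean value inequality, applied to the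
derivative and then to `f`, bounds both first-order remainders by `Cd ‖v‖²`. The linear terms at `v`
and `-v` cancel. -/
lemma abs_second_difference_le {d : ℕ} {f : EuclideanSpace ℝ (Fin d) → ℝ} {Cd : ℝ}
    {x v : EuclideanSpace ℝ (Fin d)} (hx : x ∉ sweep {x | ¬ HessianBoundAt f Cd x} v) :
    |f (x + v) + f (x - v) - 2 * f x| ≤ 2 * Cd * ‖v‖ ^ 2 := by
  set s : Set (EuclideanSpace ℝ (Fin d)) := (fun t : ℝ => x + t • v) '' Set.Icc (-1) 1 with hs
  have hconv : Convex ℝ s := by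
    have : s = AffineMap.lineMap x (x + v) '' Set.Icc (-1 : ℝ) 1 := by
      refine Set.image_congr fun t _ => ?_
      simp [AffineMap.lineMap_apply, add_comm]
    rw [this]
    exact (convex_Icc _ _).affine_image _
  have hgood : ∀ y ∈ s, HessianBoundAt f Cd y := by
    rintro _ ⟨t, ht, rfl⟩
    by_contra h
    exact hx ⟨t, ht, h⟩
  have hxs : x ∈ s := ⟨0, by norm_num, by simp⟩
  have hps : x + v ∈ s := ⟨1, by norm_num, by simp⟩
  have hms : x - v ∈ s := ⟨-1, by norm_num, by simp [sub_eq_add_neg]⟩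
  have hCd : 0 ≤ Cd := (norm_nonneg _).trans (hgood x hxs).2.le
  have hdist : ∀ y ∈ s, ‖y - x‖ ≤ ‖v‖ := by
    rintro _ ⟨t, ht, rfl⟩
    simp only [add_sub_cancel_left, norm_smul, Real.norm_eq_abs]
    exact mul_le_of_le_one_left (norm_nonneg _) (abs_le.2 ht)
  have hgrad : ∀ y ∈ s, ‖fderiv ℝ f y - fderiv ℝ f x‖ ≤ Cd * ‖v‖ := by
    intro y hy
    refine (hconv.norm_image_sub_le_of_norm_fderiv_le (f := fderiv ℝ f) (C := Cd) (𝕜 := ℝ)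
      (fun z hz => ?_) (fun z hz => ?_) hxs hy).trans ?_
    · exact ((hgood z hz).1.fderiv_right (m := 1) (by norm_num)).differentiableAt (by norm_num)
    · rw [← norm_iteratedFDeriv_one, norm_iteratedFDeriv_fderiv]
      exact (hgood z hz).2.le
    · gcongr; exact hdist y hy
  have hfirst : ∀ y ∈ s, ‖f y - f x - fderiv ℝ f x (y - x)‖ ≤ Cd * ‖v‖ * ‖v‖ := by
    intro y hy
    refine (hconv.norm_image_sub_le_of_norm_fderiv_le' (𝕜 := ℝ)
      (fun z hz => (hgood z hz).1.differentiableAt (by norm_num)) hgrad hxs hy).trans ?_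
    gcongr; exact hdist y hy
  have h1 := hfirst _ hps
  have h2 := hfirst _ hms
  rw [Real.norm_eq_abs, abs_le] at h1 h2
  have e1 : x + v - x = v := by abel
  have e2 : x - v - x = -v := by abel
  rw [e1] at h1
  rw [e2, map_neg] at h2
  rw [abs_le]
  constructor <;> nlinarith [h1.1, h1.2, h2.1, h2.2]

/-! ### The `ℓ_p` norm and the volume of its balls -/

section Norm

open scoped Pointwise

variable {d : ℕ} (p : ℝ≥0∞) [Fact (1 ≤ p)]

lemma exists_pNorm_eq_norm : ∃ e : EuclideanSpace ℝ (Fin d) ≃L[ℝ] PiLp p (fun _ : Fin d => ℝ),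
    ∀ x, pNorm p x = ‖e x‖ :=
  ⟨((WithLp.linearEquiv 2 ℝ (Fin d → ℝ)).trans
    (WithLp.linearEquiv p ℝ (Fin d → ℝ)).symm).toContinuousLinearEquiv, fun _ => rfl⟩

lemma continuous_pNorm : Continuous (pNorm (d := d) p) := by
  obtain ⟨e, he⟩ := exists_pNorm_eq_norm (d := d) p
  rw [show pNorm (d := d) p = fun x => ‖e x‖ from funext he]
  fun_prop

lemma pNorm_nonneg (x : EuclideanSpace ℝ (Fin d)) : 0 ≤ pNorm p x := norm_nonneg _

lemma pNorm_neg (x : EuclideanSpace ℝ (Fin d)) : pNorm p (-x) = pNorm p x := by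
  obtain ⟨e, he⟩ := exists_pNorm_eq_norm (d := d) p
  rw [he, he, map_neg, norm_neg]

lemma pNorm_smul (c : ℝ) (x : EuclideanSpace ℝ (Fin d)) : pNorm p (c • x) = |c| * pNorm p x := by
  obtain ⟨e, he⟩ := exists_pNorm_eq_norm (d := d) p
  rw [he, he, map_smul, norm_smul, Real.norm_eq_abs]

lemma exists_norm_le_mul_pNorm (d : ℕ) :
    ∃ κ : ℝ, 0 < κ ∧ ∀ x : EuclideanSpace ℝ (Fin d), ‖x‖ ≤ κ * pNorm p x := by
  obtain ⟨e, he⟩ := exists_pNorm_eq_norm (d := d) p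
  refine ⟨‖(e.symm : PiLp p (fun _ : Fin d => ℝ) →L[ℝ] EuclideanSpace ℝ (Fin d))‖ + 1,
    by positivity, fun x => ?_⟩
  rw [he]
  have h := (e.symm : PiLp p (fun _ : Fin d => ℝ) →L[ℝ] EuclideanSpace ℝ (Fin d)).le_opNorm (e x)
  simp only [ContinuousLinearEquiv.coe_coe, ContinuousLinearEquiv.symm_apply_apply] at h
  nlinarith [norm_nonneg (e x)]

/-- The closed `ℓ_p` ball. -/
def lpBall (x : EuclideanSpace ℝ (Fin d)) (r : ℝ) : Set (EuclideanSpace ℝ (Fin d)) :=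
  {y | pNorm p (y - x) ≤ r}

lemma measurableSet_lpBall (x : EuclideanSpace ℝ (Fin d)) (r : ℝ) :
    MeasurableSet (lpBall p x r) :=
  (isClosed_le ((continuous_pNorm p).comp (by fun_prop)) continuous_const).measurableSet

/-- The point is finiteness: the ball is bounded in the Euclidean norm, so `toReal` in
`unitBallVolume` loses nothing. -/
lemma volume_lpBall_zero_one : volume (lpBall p (0 : EuclideanSpace ℝ (Fin d)) 1) =
    ENNReal.ofReal (unitBallVolume d p) := by
  obtain ⟨κ, -, h⟩ := exists_norm_le_mul_pNorm p d
  have hset : {x : EuclideanSpace ℝ (Fin d) | pNorm p x ≤ 1} = lpBall p 0 1 := by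
    ext; simp [lpBall]
  have hfin : volume (lpBall p (0 : EuclideanSpace ℝ (Fin d)) 1) ≠ ∞ := by
    refine (Bornology.IsBounded.measure_lt_top ?_).ne
    refine (Metric.isBounded_closedBall (x := 0) (r := |κ|)).subset fun x hx => ?_
    have h1 : pNorm p x ≤ 1 := by simpa [lpBall] using hx
    rw [mem_closedBall_zero_iff]
    refine (h x).trans ((le_abs_self _).trans ?_)
    rw [abs_mul, abs_of_nonneg (pNorm_nonneg p x)]
    exact mul_le_of_le_one_right (abs_nonneg _) h1
  rw [unitBallVolume, hset, ENNReal.ofReal_toReal hfin]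

lemma unitBallVolume_pos : 0 < unitBallVolume d p := by
  have h : 0 < volume (lpBall p (0 : EuclideanSpace ℝ (Fin d)) 1) := by
    refine lt_of_lt_of_le ((isOpen_lt (continuous_pNorm (d := d) p)
      (continuous_const (y := (1 : ℝ)))).measure_pos volume ⟨0, ?_⟩) (measure_mono fun x hx => ?_)
    · have := pNorm_smul p 0 (0 : EuclideanSpace ℝ (Fin d))
      simp only [zero_smul, abs_zero, zero_mul] at this
      simp [this]
    · simpa [lpBall] using (le_of_lt hx : pNorm p x ≤ 1)
  rw [volume_lpBall_zero_one] at h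
  simpa using h

lemma volume_lpBall (x : EuclideanSpace ℝ (Fin d)) {r : ℝ} (hr : 0 < r) :
    volume (lpBall p x r) = ENNReal.ofReal (unitBallVolume d p * r ^ d) := by
  have h1 : lpBall p x r = (fun y => y + -x) ⁻¹' (r • lpBall p 0 1) := by
    ext y
    rw [Set.mem_preimage, Set.mem_smul_set_iff_inv_smul_mem₀ hr.ne']
    simp only [lpBall, Set.mem_ofPred_eq, sub_zero, pNorm_smul, abs_inv, abs_of_pos hr,
      ← sub_eq_add_neg]
    rw [inv_mul_le_iff₀ hr, mul_one]
  rw [h1, measure_preimage_add_right, Measure.addHaar_smul, volume_lpBall_zero_one,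
    ← ENNReal.ofReal_mul (abs_nonneg _), finrank_euclideanSpace_fin, abs_of_pos (pow_pos hr d),
    mul_comm]

end Norm

/-! ### The law of one sample, and the lower bound for its density -/

/-- The probability measure with density `f`. -/
noncomputable def densityMeasure {d : ℕ} (f : EuclideanSpace ℝ (Fin d) → ℝ) :
    Measure (EuclideanSpace ℝ (Fin d)) :=
  volume.withDensity fun x => ENNReal.ofReal (f x)

section Density

variable {d : ℕ} {f : EuclideanSpace ℝ (Fin d) → ℝ}

lemma IsDensity.isProbabilityMeasure (hf : IsDensity f) :
    IsProbabilityMeasure (densityMeasure f) := by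
  constructor
  rw [densityMeasure, withDensity_apply _ MeasurableSet.univ, Measure.restrict_univ,
    ← ofReal_integral_eq_lintegral_ofReal hf.integrable (ae_of_all _ hf.nonneg),
    hf.integral_eq_one, ENNReal.ofReal_one]

lemma densityMeasure_ac : densityMeasure f ≪ volume := withDensity_absolutelyContinuous _ _

lemma IsDensity.integral_densityMeasure (hf : IsDensity f) (g : EuclideanSpace ℝ (Fin d) → ℝ) :
    ∫ x, g x ∂densityMeasure f = ∫ x, f x * g x := by
  have h := integral_withDensity_eq_integral_smul (μ := (volume : Measure (EuclideanSpace ℝ (Fin d))))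
    hf.measurable.real_toNNReal g
  rw [densityMeasure]
  refine h.trans (integral_congr_ae (ae_of_all _ fun x => ?_))
  simp [NNReal.smul_def, hf.nonneg x]

lemma IsDensity.integrable_densityMeasure_iff (hf : IsDensity f)
    (g : EuclideanSpace ℝ (Fin d) → ℝ) :
    Integrable g (densityMeasure f) ↔ Integrable fun x => f x * g x := by
  have h := integrable_withDensity_iff_integrable_smul₀
    (μ := (volume : Measure (EuclideanSpace ℝ (Fin d))))
    hf.measurable.real_toNNReal.aemeasurable (g := g)
  rw [densityMeasure]
  refine h.trans (integrable_congr (ae_of_all _ fun x => ?_))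
  simp [NNReal.smul_def, hf.nonneg x]

lemma IsDensity.densityMeasure_toReal (hf : IsDensity f) {s : Set (EuclideanSpace ℝ (Fin d))}
    (hs : MeasurableSet s) : (densityMeasure f).real s = ∫ x in s, f x := by
  rw [Measure.real, densityMeasure, withDensity_apply _ hs,
    ← ofReal_integral_eq_lintegral_ofReal hf.integrable.integrableOn (ae_of_all _ hf.nonneg),
    ENNReal.toReal_ofReal (integral_nonneg hf.nonneg)]

lemma densityMeasure_le {Ca : ℝ} (hCa : ∀ᵐ x, f x ≤ Ca) {s : Set (EuclideanSpace ℝ (Fin d))}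
    (hs : MeasurableSet s) : densityMeasure f s ≤ ENNReal.ofReal Ca * volume s := by
  rw [densityMeasure, withDensity_apply _ hs, ← setLIntegral_const]
  refine lintegral_mono_ae (ae_restrict_of_ae ?_)
  filter_upwards [hCa] with x hx using ENNReal.ofReal_le_ofReal hx

/-- The tail condition forces the density to be at least `C0` on its support. -/
lemma RegularDensity.le_ae {Ca Cb Cc Cd Ce C0 : ℝ} (hf : IsDensity f)
    (hR : RegularDensity f Ca Cb Cc Cd Ce C0) : ∀ᵐ x ∂densityMeasure f, C0 ≤ f x := by
  have := hf.isProbabilityMeasure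
  have key : ∀ s < C0, ∀ᵐ x ∂densityMeasure f, s < f x := by
    intro s hs
    have hmeas : MeasurableSet {x | f x ≤ s} := measurableSet_le hf.measurable measurable_const
    -- Markov's inequality for `exp (-b f)`, which is at least `exp (-b s)` where `f ≤ s`. Since `s
    -- < C0` the bound tends to `0` as `b → ∞`, while the left side does not depend on `b`.
    have hbound : ∀ b : ℝ, 1 < b →
        (densityMeasure f).real {x | f x ≤ s} ≤ Cc * Real.exp (-(C0 - s) * b) := by
      intro b hb
      have h1 := hR.tail b hb
      rw [← hf.integral_densityMeasure] at h1
      have hint : Integrable (fun x => Real.exp (-b * f x)) (densityMeasure f) := by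
        refine Integrable.of_bound (C := 1)
          (Real.measurable_exp.comp (hf.measurable.const_mul _)).aestronglyMeasurable
          (ae_of_all _ fun x => ?_)
        rw [Real.norm_eq_abs, Real.abs_exp, Real.exp_le_one_iff]
        nlinarith [hf.nonneg x]
      have h2 : Real.exp (-b * s) * (densityMeasure f).real {x | f x ≤ s} ≤
          ∫ x, Real.exp (-b * f x) ∂densityMeasure f := by
        refine (setIntegral_ge_of_const_le_real hmeas (measure_ne_top _ _) (fun x hx => ?_)
          hint.integrableOn).trans (setIntegral_le_integral hint (ae_of_all _ fun x => by positivity))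
        have hx' : f x ≤ s := hx
        exact Real.exp_le_exp.2 (by nlinarith)
      have h3 : Real.exp (-b * s) * (densityMeasure f).real {x | f x ≤ s} ≤
          Real.exp (-b * s) * (Cc * Real.exp (-(C0 - s) * b)) := by
        refine (h2.trans h1).trans_eq ?_
        rw [mul_left_comm, ← Real.exp_add]; congr 2; ring
      exact le_of_mul_le_mul_left h3 (Real.exp_pos _)
    have hlim : Filter.Tendsto (fun b : ℝ => Cc * Real.exp (-(C0 - s) * b)) Filter.atTop
        (nhds (Cc * 0)) := by
      refine (Real.tendsto_exp_atBot.comp ?_).const_mul _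
      exact Filter.Tendsto.const_mul_atTop_of_neg (by linarith) Filter.tendsto_id
    have hzero : (densityMeasure f).real {x | f x ≤ s} ≤ Cc * 0 :=
      ge_of_tendsto hlim (Filter.eventually_atTop.2 ⟨2, fun b hb => hbound b (by linarith)⟩)
    rw [mul_zero] at hzero
    have h0 : densityMeasure f {x | f x ≤ s} = 0 :=
      (measureReal_eq_zero_iff).1 (le_antisymm hzero measureReal_nonneg)
    rw [ae_iff]; simpa using h0
  have hall : ∀ᵐ x ∂densityMeasure f, ∀ n : ℕ, C0 - 1 / ((n : ℝ) + 1) < f x :=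
    ae_all_iff.2 fun n => key _ (by have : 0 < 1 / ((n : ℝ) + 1) := by positivity
                                    linarith)
  filter_upwards [hall] with x hx
  have hl : Filter.Tendsto (fun n : ℕ => C0 - 1 / ((n : ℝ) + 1)) Filter.atTop (nhds (C0 - 0)) :=
    tendsto_one_div_add_atTop_nhds_zero_nat.const_sub _
  rw [sub_zero] at hl
  exact le_of_tendsto' hl fun n => (hx n).le

end Density

/-! ### Mass of a small ball against density times volume -/

section BallError

variable {d : ℕ} {f : EuclideanSpace ℝ (Fin d) → ℝ} (p : ℝ≥0∞) [Fact (1 ≤ p)]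

lemma measurable_densityMeasure_lpBall (hf : IsDensity f) (r : ℝ) :
    Measurable fun x => (densityMeasure f).real (lpBall p x r) := by
  have := hf.isProbabilityMeasure
  have hs : MeasurableSet {q : EuclideanSpace ℝ (Fin d) × EuclideanSpace ℝ (Fin d) |
      pNorm p (q.2 - q.1) ≤ r} :=
    (isClosed_le ((continuous_pNorm p).comp (by fun_prop)) continuous_const).measurableSet
  exact (measurable_measure_prodMk_left (ν := densityMeasure f) hs).ennreal_toReal

/-- Symmetry of the ball allows averaging over `v` and `-v`, which brings in the second difference
and so removes the gradient of `f`. -/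
lemma densityMeasure_lpBall_eq_integral (hf : IsDensity f) (x : EuclideanSpace ℝ (Fin d)) (r : ℝ) :
    (densityMeasure f).real (lpBall p x r) =
      ∫ v in lpBall p 0 r, (1 / 2 : ℝ) * (f (x + v) + f (x - v)) := by
  have hp : ∫ v in lpBall p 0 r, f (x + v) = ∫ y in lpBall p x r, f y := by
    have h := (measurePreserving_add_left volume x).setIntegral_preimage_emb
      (measurableEmbedding_addLeft x) f (lpBall p x r)
    rw [← h]
    congr 2
    ext v; simp [lpBall]
  have hm : ∫ v in lpBall p 0 r, f (x - v) = ∫ y in lpBall p x r, f y := by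
    have h := (Measure.measurePreserving_sub_left volume x).setIntegral_preimage_emb
      (MeasurableEquiv.subLeft x).measurableEmbedding f (lpBall p x r)
    rw [← h]
    congr 2
    ext v; simp [lpBall, pNorm_neg]
  have hip : Integrable fun v => f (x + v) := hf.integrable.comp_add_left x
  have him : Integrable fun v => f (x - v) := hf.integrable.comp_sub_left x
  rw [integral_const_mul, integral_add hip.integrableOn him.integrableOn, hp, hm,
    hf.densityMeasure_toReal (measurableSet_lpBall p x r)]
  ring

/-- Off the sweep of the exceptional set the Hessian bound applies. On it only `0 ≤ f ≤ Ca` is used,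
but the sweep has mass at most `Ca` times its volume `O(‖v‖)`. This first-order term is what limits
the rate. -/
lemma lintegral_second_difference_le (hd : 1 ≤ d) {Ca Cb Cc Cd Ce C0 : ℝ} (hf : IsDensity f)
    (hR : RegularDensity f Ca Cb Cc Cd Ce C0) (v : EuclideanSpace ℝ (Fin d)) :
    ∫⁻ x, ‖(1 / 2 : ℝ) * (f (x + v) + f (x - v) - 2 * f x)‖ₑ ∂densityMeasure f ≤
      ENNReal.ofReal (|Cd| * ‖v‖ ^ 2 + |Ca| * (|Ca| * (4 * ‖v‖ * 2 ^ (d - 1) * |Ce|))) := by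
  have := hf.isProbabilityMeasure
  rcases eq_or_ne v 0 with rfl | hv
  · have : ∀ x, (1 / 2 : ℝ) * (f (x + 0) + f (x - 0) - 2 * f x) = 0 := fun x => by
      rw [add_zero, sub_zero]; ring
    simp only [this, enorm_zero, lintegral_zero, zero_le]
  -- The sweep is not known to be measurable, so a measurable hull of the same volume replaces it.
  set T := toMeasurable volume (sweep {x | ¬ HessianBoundAt f Cd x} v) with hT
  have hTm : MeasurableSet T := measurableSet_toMeasurable _ _
  have hpt : ∀ᵐ x ∂densityMeasure f, ‖(1 / 2 : ℝ) * (f (x + v) + f (x - v) - 2 * f x)‖ₑ ≤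
      ENNReal.ofReal (|Cd| * ‖v‖ ^ 2) + T.indicator (fun _ => ENNReal.ofReal |Ca|) x := by
    have h1 := hR.bounded
    have h2 := (measurePreserving_add_right volume v).quasiMeasurePreserving.ae hR.bounded
    have h3 := (measurePreserving_sub_right volume v).quasiMeasurePreserving.ae hR.bounded
    refine densityMeasure_ac.ae_le ?_
    filter_upwards [h1, h2, h3] with x hx1 hx2 hx3
    rw [← ofReal_norm, Real.norm_eq_abs, abs_mul]
    by_cases hx : x ∈ T
    · rw [Set.indicator_of_mem hx]
      refine le_add_left (ENNReal.ofReal_le_ofReal ?_)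
      have hb : |f (x + v) + f (x - v) - 2 * f x| ≤ 2 * |Ca| := by
        have := le_abs_self Ca
        have := hf.nonneg x
        have := hf.nonneg (x + v)
        have := hf.nonneg (x - v)
        rw [abs_le]; constructor <;> linarith
      rw [abs_of_pos (by norm_num : (0 : ℝ) < 1 / 2)]
      linarith
    · refine le_add_right (ENNReal.ofReal_le_ofReal ?_)
      have hb := abs_second_difference_le (f := f) (Cd := Cd)
        (fun h => hx (subset_toMeasurable volume _ h))
      rw [abs_of_pos (by norm_num : (0 : ℝ) < 1 / 2)]
      have : Cd * ‖v‖ ^ 2 ≤ |Cd| * ‖v‖ ^ 2 := by gcongr; exact le_abs_self _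
      linarith
  refine (lintegral_mono_ae hpt).trans ?_
  rw [lintegral_add_left measurable_const, lintegral_const, measure_univ, mul_one,
    lintegral_indicator_const hTm, ENNReal.ofReal_add (by positivity) (by positivity),
    ENNReal.ofReal_mul (abs_nonneg Ca)]
  gcongr
  refine (densityMeasure_le hR.bounded hTm).trans ?_
  rw [ENNReal.ofReal_mul (abs_nonneg Ca)]
  gcongr
  · exact le_abs_self _
  rw [hT, measure_toMeasurable]
  refine (volume_sweep_le hd hR.hausdorff hv).trans ?_
  rw [ENNReal.ofReal_mul (by positivity : (0 : ℝ) ≤ 4 * ‖v‖ * 2 ^ (d - 1)),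
    ENNReal.ofReal_mul (by positivity : (0 : ℝ) ≤ 4 * ‖v‖), ENNReal.ofReal_pow (by norm_num)]
  gcongr
  · simp
  · exact le_abs_self _

/-- On average, the mass of a small ball is close to its volume times the density at the centre. -/
lemma exists_ball_error_le (hd : 1 ≤ d) (Ca Cd Ce : ℝ) :
    ∃ K : ℝ, 0 < K ∧ ∀ (Cb Cc C0 : ℝ) (f : EuclideanSpace ℝ (Fin d) → ℝ), IsDensity f →
      RegularDensity f Ca Cb Cc Cd Ce C0 → ∀ r : ℝ, 0 < r → r ≤ 1 →
      Integrable (fun x => (densityMeasure f).real (lpBall p x r) -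
        f x * (unitBallVolume d p * r ^ d)) (densityMeasure f) ∧
      ∫ x, |(densityMeasure f).real (lpBall p x r) - f x * (unitBallVolume d p * r ^ d)|
        ∂densityMeasure f ≤ K * r ^ (d + 1) := by
  obtain ⟨κ, hκ, hκn⟩ := exists_norm_le_mul_pNorm p d
  have hc := unitBallVolume_pos (d := d) p
  set c := unitBallVolume d p with hcdef
  set K₁ : ℝ := |Cd| * κ ^ 2 + |Ca| * (|Ca| * (4 * κ * 2 ^ (d - 1) * |Ce|)) with hK₁
  have hK₁0 : 0 ≤ K₁ := by positivity
  -- The summand `1` serves only to make the constant positive.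
  refine ⟨K₁ * c + 1, by positivity, fun Cb Cc C0 f hf hR r hr hr1 => ?_⟩
  have := hf.isProbabilityMeasure
  have hvol := volume_lpBall p (0 : EuclideanSpace ℝ (Fin d)) hr
  have hvolr : volume.real (lpBall p (0 : EuclideanSpace ℝ (Fin d)) r) = c * r ^ d := by
    rw [Measure.real, hvol, ENNReal.toReal_ofReal (by positivity)]
  have hrepr : ∀ x, (densityMeasure f).real (lpBall p x r) - f x * (c * r ^ d) =
      ∫ v in lpBall p 0 r, (1 / 2 : ℝ) * (f (x + v) + f (x - v) - 2 * f x) := by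
    intro x
    have hip : Integrable fun v => f (x + v) := hf.integrable.comp_add_left x
    have him : Integrable fun v => f (x - v) := hf.integrable.comp_sub_left x
    have hcst : ∫ v in lpBall p (0 : EuclideanSpace ℝ (Fin d)) r, f x = f x * (c * r ^ d) := by
      rw [setIntegral_const, hvolr, smul_eq_mul, mul_comm]
    rw [densityMeasure_lpBall_eq_integral p hf, ← hcst, ← integral_sub]
    · congr 1; ext v; ring
    · exact ((hip.add him).const_mul _).integrableOn
    · exact integrableOn_const (by rw [hvol]; exact ENNReal.ofReal_ne_top)
  have hmeas : Measurable fun x => (densityMeasure f).real (lpBall p x r) - f x * (c * r ^ d) :=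
    (measurable_densityMeasure_lpBall p hf r).sub (hf.measurable.mul_const _)
  have hfm := hf.measurable
  have hbound : ∫⁻ x, ‖(densityMeasure f).real (lpBall p x r) - f x * (c * r ^ d)‖ₑ
      ∂densityMeasure f ≤ ENNReal.ofReal (K₁ * r * (c * r ^ d)) := by
    -- By Tonelli, `x` is integrated first: for fixed `v` the second difference has mean `O(r)`, and
    -- the integral over `v` contributes the volume `c r^d`.
    calc _ ≤ ∫⁻ x, (∫⁻ v in lpBall p 0 r,
            ‖(1 / 2 : ℝ) * (f (x + v) + f (x - v) - 2 * f x)‖ₑ) ∂densityMeasure f := by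
          refine lintegral_mono fun x => ?_
          rw [hrepr]
          exact enorm_integral_le_lintegral_enorm _
      _ = ∫⁻ v in lpBall p 0 r, (∫⁻ x,
            ‖(1 / 2 : ℝ) * (f (x + v) + f (x - v) - 2 * f x)‖ₑ ∂densityMeasure f) := by
          refine lintegral_lintegral_swap (Measurable.aemeasurable ?_)
          simp only [Function.uncurry_def]
          fun_prop
      _ ≤ ∫⁻ v in lpBall p (0 : EuclideanSpace ℝ (Fin d)) r, ENNReal.ofReal (K₁ * r) := by
          refine setLIntegral_mono measurable_const fun v hv => ?_
          refine (lintegral_second_difference_le hd hf hR v).trans (ENNReal.ofReal_le_ofReal ?_)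
          have hv' : pNorm p v ≤ r := by simpa [lpBall] using hv
          have hvn : ‖v‖ ≤ κ * r := (hκn v).trans (by gcongr)
          calc _ ≤ |Cd| * (κ * r) ^ 2 + |Ca| * (|Ca| * (4 * (κ * r) * 2 ^ (d - 1) * |Ce|)) := by
                gcongr
            _ ≤ |Cd| * (κ ^ 2 * r) + |Ca| * (|Ca| * (4 * (κ * r) * 2 ^ (d - 1) * |Ce|)) := by
                gcongr
                rw [mul_pow]
                gcongr
                nlinarith
            _ = K₁ * r := by rw [hK₁]; ring
      _ = _ := by
          rw [setLIntegral_const, hvol, ← ENNReal.ofReal_mul (by positivity)]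
  refine ⟨⟨hmeas.aestronglyMeasurable, hbound.trans_lt ENNReal.ofReal_lt_top⟩, ?_⟩
  have h1 : ∫ x, ‖(densityMeasure f).real (lpBall p x r) - f x * (c * r ^ d)‖ ∂densityMeasure f ≤
      K₁ * r * (c * r ^ d) := by
    rw [integral_norm_eq_lintegral_enorm hmeas.aestronglyMeasurable]
    exact ENNReal.toReal_le_of_le_ofReal (by positivity) hbound
  refine h1.trans ?_
  have : 0 < r ^ (d + 1) := by positivity
  calc _ = K₁ * c * r ^ (d + 1) := by ring
    _ ≤ _ := by gcongr; linarith

end BallError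

/-! ### Binomial tails and their logarithmic primitive -/

section BinomialTail

/-- The probability that a binomial variable with parameters `M` and `u` is at least `k`. -/
noncomputable def binomTail (M k : ℕ) (u : ℝ) : ℝ :=
  ∑ j ∈ Finset.Ico k (M + 1), (bernsteinPolynomial ℝ M j).eval u

/-- The antiderivative of `binomTail M k u / u` that vanishes at `0`. -/
noncomputable def binomTailPrimitive (M k : ℕ) (u : ℝ) : ℝ :=
  ∑ j ∈ Finset.Ico k (M + 1), binomTail M j u / j

lemma bernstein_eval (M j : ℕ) (u : ℝ) : (bernsteinPolynomial ℝ M j).eval u =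
    (M.choose j : ℝ) * u ^ j * (1 - u) ^ (M - j) := by
  simp [bernsteinPolynomial]

lemma bernstein_eval_nonneg (M j : ℕ) {u : ℝ} (hu : u ∈ Set.Icc (0 : ℝ) 1) :
    0 ≤ (bernsteinPolynomial ℝ M j).eval u := by
  rw [bernstein_eval]
  have := hu.1
  have : 0 ≤ 1 - u := by linarith [hu.2]
  positivity

lemma sum_bernstein_eval (M : ℕ) (u : ℝ) :
    ∑ j ∈ Finset.range (M + 1), (bernsteinPolynomial ℝ M j).eval u = 1 := by
  rw [← Polynomial.eval_finsetSum, bernsteinPolynomial.sum, Polynomial.eval_one]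

lemma bernstein_eval_le_one (M j : ℕ) {u : ℝ} (hu : u ∈ Set.Icc (0 : ℝ) 1) :
    (bernsteinPolynomial ℝ M j).eval u ≤ 1 := by
  rcases lt_or_ge M j with h | h
  · simp [bernsteinPolynomial.eq_zero_of_lt ℝ h]
  · rw [← sum_bernstein_eval M u]
    exact Finset.single_le_sum (f := fun j => (bernsteinPolynomial ℝ M j).eval u)
      (fun i _ => bernstein_eval_nonneg M i hu) (Finset.mem_range.2 (by omega))

lemma binomTail_nonneg (M k : ℕ) {u : ℝ} (hu : u ∈ Set.Icc (0 : ℝ) 1) : 0 ≤ binomTail M k u :=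
  Finset.sum_nonneg fun j _ => bernstein_eval_nonneg M j hu

lemma binomTail_add {M k : ℕ} (hk : k ≤ M) (u : ℝ) :
    binomTail M k u + ∑ j ∈ Finset.range k, (bernsteinPolynomial ℝ M j).eval u = 1 := by
  rw [← sum_bernstein_eval M u, binomTail, add_comm, Finset.sum_range_add_sum_Ico _ (by omega)]

lemma binomTail_le_one {M k : ℕ} (hk : k ≤ M) {u : ℝ} (hu : u ∈ Set.Icc (0 : ℝ) 1) :
    binomTail M k u ≤ 1 := by
  have := Finset.sum_nonneg fun j (_ : j ∈ Finset.range k) => bernstein_eval_nonneg M j hu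
  linarith [binomTail_add hk u]

/-- The derivative of a Bernstein polynomial is `M` times the difference of two neighbours of degree
`M - 1`, so the sum telescopes. One nonnegative term, at most `1` on `[0, 1]`, survives; it gives
both monotonicity and the Lipschitz constant `M`. -/
lemma hasDerivAt_binomTail (M k : ℕ) (u : ℝ) (hkM : k < M) :
    HasDerivAt (binomTail M (k + 1)) (M * (bernsteinPolynomial ℝ (M - 1) k).eval u) u := by
  have h1 : HasDerivAt (binomTail M (k + 1))
      (∑ j ∈ Finset.Ico (k + 1) (M + 1), (bernsteinPolynomial ℝ M j).derivative.eval u) u :=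
    HasDerivAt.fun_sum fun j _ => (bernsteinPolynomial ℝ M j).hasDerivAt u
  convert h1 using 1
  rw [← Finset.sum_Ico_add' (fun j => (bernsteinPolynomial ℝ M j).derivative.eval u) k M 1]
  simp only [bernsteinPolynomial.derivative_succ, Polynomial.eval_mul, Polynomial.eval_sub,
    Polynomial.eval_natCast]
  rw [← Finset.mul_sum, Finset.sum_Ico_eq_sum_range]
  have h2 := Finset.sum_range_sub' (fun i => (bernsteinPolynomial ℝ (M - 1) (k + i)).eval u) (M - k)
  simp only [← add_assoc] at h2
  rw [h2, show k + (M - k) = M by omega, bernsteinPolynomial.eq_zero_of_lt ℝ (by omega : M - 1 < M)]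
  simp

lemma continuous_binomTail (M k : ℕ) : Continuous (binomTail M k) :=
  continuous_finsetSum _ fun j _ => (bernsteinPolynomial ℝ M j).continuous

lemma abs_binomTail_sub_le {M k : ℕ} (hk : 1 ≤ k) (hkM : k ≤ M) {u v : ℝ}
    (hu : u ∈ Set.Icc (0 : ℝ) 1) (hv : v ∈ Set.Icc (0 : ℝ) 1) :
    |binomTail M k u - binomTail M k v| ≤ M * |u - v| := by
  obtain ⟨k, rfl⟩ := Nat.exists_eq_add_of_le' hk
  refine (convex_Icc (0 : ℝ) 1).norm_image_sub_le_of_norm_hasDerivWithin_le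
    (fun x _ => (hasDerivAt_binomTail M k x (by omega)).hasDerivWithinAt) (fun x hx => ?_) hv hu
  rw [Real.norm_eq_abs, abs_of_nonneg (mul_nonneg M.cast_nonneg (bernstein_eval_nonneg _ _ hx))]
  exact mul_le_of_le_one_right M.cast_nonneg (bernstein_eval_le_one _ _ hx)

lemma monotoneOn_binomTail {M k : ℕ} (hk : 1 ≤ k) (hkM : k ≤ M) :
    MonotoneOn (binomTail M k) (Set.Icc 0 1) := by
  obtain ⟨k, rfl⟩ := Nat.exists_eq_add_of_le' hk
  refine monotoneOn_of_deriv_nonneg (convex_Icc 0 1) (continuous_binomTail _ _).continuousOn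
    (fun x _ => (hasDerivAt_binomTail M k x (by omega)).differentiableAt.differentiableWithinAt)
    fun x hx => ?_
  rw [(hasDerivAt_binomTail M k x (by omega)).deriv]
  exact mul_nonneg M.cast_nonneg (bernstein_eval_nonneg _ _ (interior_subset hx))

lemma binomTail_zero {M k : ℕ} (hk : 1 ≤ k) : binomTail M k 0 = 0 :=
  Finset.sum_eq_zero fun j hj => by
    have := (Finset.mem_Ico.1 hj).1
    rw [bernstein_eval, zero_pow (by omega)]; simp

lemma binomTail_one {M k : ℕ} (hkM : k ≤ M) : binomTail M k 1 = 1 := by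
  rw [binomTail, Finset.sum_eq_single M]
  · simp [bernstein_eval]
  · intro j hj hne
    have := (Finset.mem_Ico.1 hj).2
    rw [bernstein_eval, sub_self, zero_pow (by omega)]; simp
  · intro h
    exact absurd (Finset.mem_Ico.2 ⟨hkM, by omega⟩) h

lemma binomTailPrimitive_zero {M k : ℕ} (hk : 1 ≤ k) : binomTailPrimitive M k 0 = 0 :=
  Finset.sum_eq_zero fun j hj => by
    rw [binomTail_zero (hk.trans (Finset.mem_Ico.1 hj).1), zero_div]

/-- All the tails equal `1` at `u = 1`, leaving the sum of `1/j` for `j` from `k` to `M`. This is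
where the harmonic numbers behind `ψ(k)` come from. -/
lemma binomTailPrimitive_one {M k : ℕ} (hk : 1 ≤ k) (hkM : k ≤ M) :
    binomTailPrimitive M k 1 = harmonic M - harmonic (k - 1) := by
  have h : binomTailPrimitive M k 1 = ∑ j ∈ Finset.Ico k (M + 1), ((j : ℝ))⁻¹ :=
    Finset.sum_congr rfl fun j hj => by
      rw [binomTail_one (by have := (Finset.mem_Ico.1 hj).2; omega), one_div]
  obtain ⟨k, rfl⟩ := Nat.exists_eq_add_of_le' hk
  rw [h, ← Finset.sum_Ico_add' (fun j : ℕ => ((j : ℝ))⁻¹) k M 1, Finset.sum_Ico_eq_sub _ (by omega)]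
  simp [harmonic]

/-- Since `M * choose (M-1) (j-1) = j * choose M j`, the derivative of the `j`-th tail divided by
`j` is the `j`-th Bernstein polynomial divided by `u`. -/
lemma hasDerivAt_binomTailPrimitive {M k : ℕ} (hk : 1 ≤ k) {u : ℝ} (hu : u ≠ 0) :
    HasDerivAt (binomTailPrimitive M k) (binomTail M k u / u) u := by
  have h : ∀ j ∈ Finset.Ico k (M + 1), HasDerivAt (fun u => binomTail M j u / j)
      ((bernsteinPolynomial ℝ M j).eval u / u) u := by
    intro j hj
    obtain ⟨h1, h2⟩ := Finset.mem_Ico.1 hj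
    obtain ⟨i, rfl⟩ := Nat.exists_eq_add_of_le' (hk.trans h1)
    obtain ⟨m, rfl⟩ := Nat.exists_eq_add_of_le' (show 1 ≤ M by omega)
    refine ((hasDerivAt_binomTail (m + 1) i u (by omega)).div_const
      ((i + 1 : ℕ) : ℝ)).congr_deriv ?_
    rw [bernstein_eval, bernstein_eval, div_eq_div_iff (by positivity) hu, pow_succ]
    have hc : ((m + 1 : ℕ) : ℝ) * (m.choose i) = ((m + 1).choose (i + 1) : ℝ) * ((i + 1 : ℕ) : ℝ) := by
      exact_mod_cast Nat.add_one_mul_choose_eq m i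
    rw [Nat.add_sub_cancel, show m + 1 - (i + 1) = m - i by omega]
    linear_combination ((u ^ i * u * (1 - u) ^ (m - i))) * hc
  rw [binomTail, Finset.sum_div]
  exact HasDerivAt.fun_sum h

lemma continuous_binomTailPrimitive (M k : ℕ) : Continuous (binomTailPrimitive M k) :=
  continuous_finsetSum _ fun j _ => (continuous_binomTail M j).div_const _

/-- The Lipschitz bound against `u = 0` gives a tail of at most `M u`, and `r ^ d ≤ r` on `(0, 1]`;
so the singularity `1/r` is harmless. -/
lemma binomTail_div_mem_Icc {M k d : ℕ} (hk : 1 ≤ k) (hkM : k ≤ M) (hd : 1 ≤ d) {s a : ℝ}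
    (hs : 0 < s) (ha1 : a ≤ 1) (hsa : s * a ^ d ≤ 1) :
    ∀ r ∈ Set.Ioc 0 a, binomTail M k (s * r ^ d) / r ∈ Set.Icc 0 (M * s) := by
  intro r hr
  have h0 : s * r ^ d ∈ Set.Icc (0 : ℝ) 1 :=
    ⟨by have := hr.1; positivity, le_trans (by have := hr.1.le; have := hr.2; gcongr) hsa⟩
  have h1 := abs_binomTail_sub_le hk hkM h0 (Set.left_mem_Icc.2 zero_le_one)
  rw [binomTail_zero hk, sub_zero, sub_zero, abs_of_nonneg (binomTail_nonneg M k h0),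
    abs_of_nonneg h0.1] at h1
  refine ⟨div_nonneg (binomTail_nonneg M k h0) hr.1.le, (div_le_iff₀ hr.1).2 (h1.trans ?_)⟩
  rw [mul_assoc]
  have : r ^ d ≤ r := pow_le_of_le_one hr.1.le (hr.2.trans ha1) (by omega)
  gcongr

/-- Substitution `u = s r^d`, under which `d dr / r` becomes `du / u`. -/
lemma integral_binomTail_div {M k d : ℕ} (hk : 1 ≤ k) (hkM : k ≤ M) (hd : 1 ≤ d) {s a : ℝ}
    (hs : 0 < s) (ha : 0 < a) (ha1 : a ≤ 1) (hsa : s * a ^ d ≤ 1) :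
    d * ∫ r in Set.Ioc 0 a, binomTail M k (s * r ^ d) / r = binomTailPrimitive M k (s * a ^ d) := by
  have hmem := binomTail_div_mem_Icc hk hkM hd hs ha1 hsa
  have hint : IntervalIntegrable (fun r => d * (binomTail M k (s * r ^ d) / r)) volume 0 a := by
    rw [intervalIntegrable_iff_integrableOn_Ioc_of_le ha.le]
    refine Integrable.const_mul (Integrable.of_bound (C := M * s) ?_ ?_) _
    · exact (((continuous_binomTail M k).measurable.comp (by fun_prop)).div
        measurable_id).aestronglyMeasurable
    · filter_upwards [ae_restrict_mem measurableSet_Ioc] with r hr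
      rw [Real.norm_eq_abs, abs_of_nonneg (hmem r hr).1]
      exact (hmem r hr).2
  have h := intervalIntegral.integral_eq_sub_of_hasDerivAt_of_le ha.le
    (f := fun r => binomTailPrimitive M k (s * r ^ d))
    ((continuous_binomTailPrimitive M k).comp (by fun_prop)).continuousOn (fun r hr => ?_) hint
  · rw [intervalIntegral.integral_of_le ha.le, integral_const_mul] at h
    rw [h, zero_pow (by omega), mul_zero, binomTailPrimitive_zero hk, sub_zero]
  · have hr0 : 0 < r := hr.1
    have h1 := (hasDerivAt_binomTailPrimitive (M := M) hk (u := s * r ^ d) (by positivity)).comp r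
      ((hasDerivAt_pow d r).const_mul s)
    refine HasDerivAt.congr_deriv h1 ?_
    obtain ⟨n, rfl⟩ := Nat.exists_eq_add_of_le' hd
    rw [Nat.add_sub_cancel]
    field_simp
    ring

/-- The primitive minus `log` has derivative `-(1 - tail)/u`. On `[w, 1]` its size is largest at
`w`, because the tail increases, and the interval has length at most `1`. -/
lemma abs_binomTailPrimitive_add_log_le {M k : ℕ} (hk : 1 ≤ k) (hkM : k ≤ M) {w : ℝ}
    (hw : 0 < w) (hw1 : w ≤ 1) :
    |binomTailPrimitive M k 1 - binomTailPrimitive M k w + Real.log w| ≤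
      (1 - binomTail M k w) / w := by
  have hwm : w ∈ Set.Icc (0 : ℝ) 1 := ⟨hw.le, hw1⟩
  have h := (convex_Icc w 1).norm_image_sub_le_of_norm_hasDerivWithin_le
    (f := fun u => binomTailPrimitive M k u - Real.log u)
    (f' := fun u => binomTail M k u / u - u⁻¹) (C := (1 - binomTail M k w) / w) (x := w) (y := 1)
    (fun u hu => ((hasDerivAt_binomTailPrimitive hk (hw.trans_le hu.1).ne').sub
      (Real.hasDerivAt_log (hw.trans_le hu.1).ne')).hasDerivWithinAt) (fun u hu => ?_)
    (Set.left_mem_Icc.2 hw1) (Set.right_mem_Icc.2 hw1)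
  · rw [Real.log_one, Real.norm_eq_abs, Real.norm_eq_abs, abs_of_nonneg (sub_nonneg.2 hw1)] at h
    have e : binomTailPrimitive M k 1 - binomTailPrimitive M k w + Real.log w =
      binomTailPrimitive M k 1 - 0 - (binomTailPrimitive M k w - Real.log w) := by ring
    rw [e]
    refine h.trans (mul_le_of_le_one_right ?_ (by linarith))
    exact div_nonneg (sub_nonneg.2 (binomTail_le_one hkM hwm)) hw.le
  · have hu0 : 0 < u := hw.trans_le hu.1
    have hum : u ∈ Set.Icc (0 : ℝ) 1 := ⟨hu0.le, hu.2⟩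
    have e : binomTail M k u / u - u⁻¹ = -((1 - binomTail M k u) / u) := by ring
    have h1 := binomTail_le_one hkM hum
    rw [e, norm_neg, Real.norm_eq_abs, abs_of_nonneg (div_nonneg (by linarith) hu0.le)]
    have := monotoneOn_binomTail hk hkM hwm hum hu.1
    exact div_le_div₀ (by linarith [binomTail_le_one hkM hwm]) (by linarith) hw hu.1

/-- Each of the `k` missing terms is at most `(uM)^j / j!` times `exp (k - uM)`. Half of the
exponent absorbs the power: `(uM)^j / j! ≤ 2^k exp (uM/2)`. -/
lemma one_sub_binomTail_le {M k : ℕ} (hkM : k ≤ M) {u : ℝ} (hu : u ∈ Set.Icc (0 : ℝ) 1) :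
    1 - binomTail M k u ≤ k * (2 ^ k * Real.exp k) * Real.exp (-(u * M / 2)) := by
  have h : ∀ j ∈ Finset.range k, (bernsteinPolynomial ℝ M j).eval u ≤
      2 ^ k * Real.exp k * Real.exp (-(u * M / 2)) := by
    intro j hj
    have hj := Finset.mem_range.1 hj
    have hu0 := hu.1
    have hu1 : 0 ≤ 1 - u := by linarith [hu.2]
    have h1 : (M.choose j : ℝ) ≤ M ^ j / (j.factorial : ℝ) := Nat.choose_le_pow_div j M
    have h2 : (1 - u) ^ (M - j) ≤ Real.exp k * Real.exp (-(u * M)) := by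
      calc (1 - u) ^ (M - j) ≤ Real.exp (-u) ^ (M - j) :=
            pow_le_pow_left₀ hu1 (by linarith [Real.add_one_le_exp (-u)]) _
        _ = Real.exp (u * j + -(u * M)) := by
            rw [← Real.exp_nat_mul, Nat.cast_sub (by omega)]; congr 1; ring
        _ ≤ Real.exp (k + -(u * M)) := by
            have : (j : ℝ) ≤ k := by exact_mod_cast hj.le
            have : u * j ≤ 1 * k := by gcongr; exact hu.2
            gcongr; linarith
        _ = _ := Real.exp_add _ _
    have h3 : (M : ℝ) ^ j / (j.factorial : ℝ) * u ^ j ≤ 2 ^ k * Real.exp (u * M / 2) := by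
      calc (M : ℝ) ^ j / (j.factorial : ℝ) * u ^ j
          = 2 ^ j * ((u * M / 2) ^ j / (j.factorial : ℝ)) := by
            rw [div_pow, mul_pow]; field_simp
        _ ≤ 2 ^ k * Real.exp (u * M / 2) := by
            gcongr
            · norm_num
            · exact Real.pow_div_factorial_le_exp _ (by positivity) j
    rw [bernstein_eval]
    calc (M.choose j : ℝ) * u ^ j * (1 - u) ^ (M - j)
        ≤ (M ^ j / (j.factorial : ℝ) * u ^ j) * (1 - u) ^ (M - j) := by gcongr
      _ ≤ (2 ^ k * Real.exp (u * M / 2)) * (Real.exp k * Real.exp (-(u * M))) := by gcongr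
      _ = 2 ^ k * Real.exp k * (Real.exp (u * M / 2) * Real.exp (-(u * M))) := by ring
      _ = _ := by rw [← Real.exp_add]; congr 2; ring
  have h4 := Finset.sum_le_sum h
  rw [Finset.sum_const, Finset.card_range, nsmul_eq_mul] at h4
  linarith [binomTail_add hkM u]

end BinomialTail

/-! ### Distribution of the nearest neighbour distance -/

/-- The event is split according to the exact set `T` of indices falling in `B`. Each piece is a
product set whose probability depends only on the size of `T`. -/
lemma pi_real_le_ncard {α : Type*} [MeasurableSpace α] (μ : Measure α) [IsProbabilityMeasure μ]
    (M k : ℕ) {B : Set α} (hB : MeasurableSet B) :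
    (Measure.pi fun _ : Fin M => μ).real {y | k ≤ Set.ncard {j | y j ∈ B}} =
      binomTail M k (μ.real B) := by
  classical
  set I : Finset (Finset (Fin M)) := Finset.univ.powerset.filter fun T => k ≤ T.card with hI
  have hset : {y : Fin M → α | k ≤ Set.ncard {j | y j ∈ B}} =
      ⋃ T ∈ I, Set.univ.pi fun j => if j ∈ T then B else Bᶜ := by
    ext y
    simp only [Set.mem_iUnion, Set.mem_univ_pi, exists_prop, Set.mem_ofPred_eq]
    constructor
    · intro h
      refine ⟨Finset.univ.filter fun j => y j ∈ B, ?_, fun j => ?_⟩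
      · rw [Set.ncard_eq_toFinset_card'] at h
        simpa [hI] using h
      · by_cases hj : y j ∈ B <;> simp [hj]
    · rintro ⟨T, hT, hy⟩
      have : {j | y j ∈ B} = (T : Set (Fin M)) := by
        ext j
        have := hy j
        by_cases hj : j ∈ T <;> simp_all
      rw [this, Set.ncard_coe_finset]
      exact (Finset.mem_filter.1 hT).2
  have hm : ∀ T : Finset (Fin M), MeasurableSet
      (Set.univ.pi fun j => if j ∈ T then B else Bᶜ : Set (Fin M → α)) := fun T =>
    MeasurableSet.univ_pi fun j => by split_ifs <;> [exact hB; exact hB.compl]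
  have hdisj : Set.PairwiseDisjoint (I : Set (Finset (Fin M)))
      fun T => (Set.univ.pi fun j => if j ∈ T then B else Bᶜ : Set (Fin M → α)) := by
    intro T _ T' _ hne
    refine Set.disjoint_left.2 fun y hy hy' => hne ?_
    ext j
    have h1 := hy j trivial
    have h2 := hy' j trivial
    by_cases hj : j ∈ T <;> by_cases hj' : j ∈ T' <;> simp_all
  rw [hset, measureReal_biUnion_finset hdisj fun T _ => hm T]
  have hval : ∀ T : Finset (Fin M), (Measure.pi fun _ : Fin M => μ).real
      (Set.univ.pi fun j => if j ∈ T then B else Bᶜ) =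
        μ.real B ^ T.card * (1 - μ.real B) ^ (M - T.card) := by
    intro T
    rw [Measure.real, Measure.pi_pi, ENNReal.toReal_prod]
    have : ∀ j, (μ (if j ∈ T then B else Bᶜ)).toReal =
        if j ∈ T then μ.real B else 1 - μ.real B := by
      intro j
      split_ifs
      · rfl
      · exact probReal_compl_eq_one_sub hB
    rw [Finset.prod_congr rfl fun j _ => this j, Finset.prod_ite, Finset.prod_const,
      Finset.prod_const]
    congr 2
    · congr 1; ext; simp
    · have h := Finset.card_compl T
      rw [Fintype.card_fin] at h
      rw [← h]; congr 1; ext; simp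
  rw [Finset.sum_congr rfl fun T _ => hval T, hI, Finset.sum_filter]
  have h := Finset.sum_powerset_apply_card
    (fun m => if k ≤ m then μ.real B ^ m * (1 - μ.real B) ^ (M - m) else 0)
    (x := (Finset.univ : Finset (Fin M)))
  rw [h, Finset.card_univ, Fintype.card_fin, binomTail,
    show Finset.Ico k (M + 1) = (Finset.range (M + 1)).filter (k ≤ ·) by ext; simp [and_comm],
    Finset.sum_filter]
  refine Finset.sum_congr rfl fun j _ => ?_
  rw [bernstein_eval]
  split_ifs
  · rw [nsmul_eq_mul, mul_assoc]
  · simp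

lemma le_ncard_iff_exists_finset {N : ℕ} (k : ℕ) (s : Set (Fin N)) :
    k ≤ s.ncard ↔ ∃ T : Finset (Fin N), T.card = k ∧ ∀ j ∈ T, j ∈ s := by
  classical
  rw [Set.ncard_eq_toFinset_card']
  constructor
  · intro h
    obtain ⟨T, hT, hc⟩ := Finset.exists_subset_card_eq h
    exact ⟨T, hc, fun j hj => Set.mem_toFinset.1 (hT hj)⟩
  · rintro ⟨T, rfl, hT⟩
    exact Finset.card_le_card fun j hj => Set.mem_toFinset.2 (hT j hj)

section KNN

variable {d M : ℕ} (p : ℝ≥0∞) [Fact (1 ≤ p)] {k : ℕ}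

lemma knnDist_nonneg {N : ℕ} (k : ℕ) (x : Fin N → EuclideanSpace ℝ (Fin d)) (i : Fin N) :
    0 ≤ knnDist p k x i :=
  Real.sInf_nonneg fun _ h => h.1

/-- The infimum is attained: the admissible radii form a closed set, nonempty because at least `k`
other samples exist. Without `k ≤ M` the set would be empty and `sInf` would return `0`. -/
lemma knnDist_le_iff (hkM : k ≤ M) (x : Fin (M + 1) → EuclideanSpace ℝ (Fin d)) (i : Fin (M + 1))
    {r : ℝ} (hr : 0 ≤ r) :
    knnDist p k x i ≤ r ↔ k ≤ Set.ncard {j | j ≠ i ∧ pNorm p (x j - x i) ≤ r} := by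
  classical
  set R : Set ℝ := {r : ℝ | 0 ≤ r ∧ k ≤ Set.ncard {j | j ≠ i ∧ pNorm p (x j - x i) ≤ r}} with hR
  have hbdd : BddBelow R := ⟨0, fun r h => h.1⟩
  have hclosed : IsClosed R := by
    have : R = Set.Ici 0 ∩ ⋃ T ∈ (Finset.univ.filter fun T : Finset (Fin (M + 1)) =>
        T.card = k ∧ i ∉ T), ⋂ j ∈ T, Set.Ici (pNorm p (x j - x i)) := by
      ext r
      simp only [hR, le_ncard_iff_exists_finset, Set.mem_inter_iff, Set.mem_iUnion, Set.mem_iInter,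
        Finset.mem_filter, Finset.mem_univ, true_and, exists_prop, Set.mem_Ici, Set.mem_ofPred_eq]
      refine and_congr_right fun _ => exists_congr fun T => ?_
      constructor
      · rintro ⟨h1, h2⟩
        exact ⟨⟨h1, fun hi => (h2 i hi).1 rfl⟩, fun j hj => (h2 j hj).2⟩
      · rintro ⟨⟨h1, h2⟩, h3⟩
        exact ⟨h1, fun j hj => ⟨fun h => h2 (h ▸ hj), h3 j hj⟩⟩
    rw [this]
    refine isClosed_Ici.inter (Set.Finite.isClosed_biUnion (Finset.finite_toSet _) fun T _ => ?_)
    exact isClosed_biInter fun j _ => isClosed_Ici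
  have hne : R.Nonempty := by
    -- The sum of all the distances is a radius that reaches every sample.
    refine ⟨∑ j, pNorm p (x j - x i), Finset.sum_nonneg fun j _ => pNorm_nonneg p _, ?_⟩
    rw [le_ncard_iff_exists_finset]
    obtain ⟨T, hT, hc⟩ := Finset.exists_subset_card_eq
      (show k ≤ (Finset.univ.erase i).card by simpa using hkM)
    exact ⟨T, hc, fun j hj => ⟨Finset.ne_of_mem_erase (hT hj),
      Finset.single_le_sum (f := fun j => pNorm p (x j - x i)) (fun j _ => pNorm_nonneg p _)
        (Finset.mem_univ j)⟩⟩
  have hmem : knnDist p k x i ∈ R := hclosed.csInf_mem hne hbdd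
  constructor
  · intro h
    refine hmem.2.trans (Set.ncard_le_ncard (fun j hj => ⟨hj.1, hj.2.trans h⟩) (Set.toFinite _))
  · intro h
    exact csInf_le hbdd ⟨hr, h⟩

lemma measurable_knnDist (hkM : k ≤ M) (i : Fin (M + 1)) :
    Measurable fun x : Fin (M + 1) → EuclideanSpace ℝ (Fin d) => knnDist p k x i := by
  refine measurable_of_Iic fun r => ?_
  rcases lt_or_ge r 0 with hr | hr
  · convert MeasurableSet.empty
    ext x
    simpa using hr.trans_le (knnDist_nonneg p k x i)
  · have : (fun x : Fin (M + 1) → EuclideanSpace ℝ (Fin d) => knnDist p k x i) ⁻¹' Set.Iic r =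
        ⋃ T ∈ {T : Finset (Fin (M + 1)) | T.card = k ∧ i ∉ T},
          ⋂ j ∈ T, {x | pNorm p (x j - x i) ≤ r} := by
      ext x
      simp only [Set.mem_preimage, Set.mem_Iic, knnDist_le_iff p hkM x i hr,
        le_ncard_iff_exists_finset, Set.mem_iUnion, Set.mem_iInter, exists_prop,
        Set.mem_ofPred_eq]
      refine exists_congr fun T => ⟨?_, ?_⟩
      · rintro ⟨h1, h2⟩
        exact ⟨⟨h1, fun hi => (h2 i hi).1 rfl⟩, fun j hj => (h2 j hj).2⟩
      · rintro ⟨⟨h1, h2⟩, h3⟩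
        exact ⟨h1, fun j hj => ⟨fun h => h2 (h ▸ hj), h3 j hj⟩⟩
    rw [this]
    refine MeasurableSet.biUnion (Set.to_countable _) fun T _ =>
      Finset.measurableSet_biInter T fun j _ => ?_
    exact (isClosed_le ((continuous_pNorm p).comp (by fun_prop)) continuous_const).measurableSet

/-- Condition on the `i`-th sample: the other `M` are still independent with the same law, and the
event says that at least `k` of them lie in the ball around it. -/
lemma pi_real_knnDist_le {f : EuclideanSpace ℝ (Fin d) → ℝ} (hf : IsDensity f) (hkM : k ≤ M)
    (i : Fin (M + 1)) {r : ℝ} (hr : 0 ≤ r) :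
    (Measure.pi fun _ : Fin (M + 1) => densityMeasure f).real {x | knnDist p k x i ≤ r} =
      ∫ x, binomTail M k ((densityMeasure f).real (lpBall p x r)) ∂densityMeasure f := by
  have := hf.isProbabilityMeasure
  set e := MeasurableEquiv.piFinSuccAbove (fun _ : Fin (M + 1) => EuclideanSpace ℝ (Fin d)) i
    with he
  have hmp : MeasurePreserving e _ _ :=
    measurePreserving_piFinSuccAbove (fun _ : Fin (M + 1) => densityMeasure f) i
  set A : Set (Fin (M + 1) → EuclideanSpace ℝ (Fin d)) := {x | knnDist p k x i ≤ r} with hA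
  have hAm : MeasurableSet A := measurable_knnDist p hkM i measurableSet_Iic
  have hsec : ∀ x, Prod.mk x ⁻¹' (e.symm ⁻¹' A) =
      {y : Fin M → EuclideanSpace ℝ (Fin d) | k ≤ Set.ncard {j | y j ∈ lpBall p x r}} := by
    intro x
    ext y
    simp only [hA, Set.mem_preimage, Set.mem_ofPred_eq]
    rw [knnDist_le_iff p hkM _ i hr, ← Set.ncard_image_of_injective _ i.succAbove_right_injective]
    congr! 2
    ext j
    rcases Fin.eq_self_or_eq_succAbove i j with rfl | ⟨j, rfl⟩
    · simp [Fin.succAbove_ne]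
    · have h1 : e.symm (x, y) (i.succAbove j) = y j :=
        Fin.insertNth_apply_succAbove (α := fun _ => EuclideanSpace ℝ (Fin d)) i x y j
      have h2 : e.symm (x, y) i = x :=
        Fin.insertNth_apply_same (α := fun _ => EuclideanSpace ℝ (Fin d)) i x y
      simp [h1, h2, lpBall, Fin.succAbove_ne]
  have hEq : (Measure.pi fun _ : Fin (M + 1) => densityMeasure f) A =
      ∫⁻ x, (Measure.pi fun _ : Fin M => densityMeasure f)
        {y | k ≤ Set.ncard {j | y j ∈ lpBall p x r}} ∂densityMeasure f := by
    rw [← (hmp.symm e).measure_preimage hAm.nullMeasurableSet,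
      Measure.prod_apply (e.symm.measurable hAm)]
    exact lintegral_congr fun x => by rw [hsec]
  have hmeas : Measurable fun x => (Measure.pi fun _ : Fin M => densityMeasure f)
        {y | k ≤ Set.ncard {j | y j ∈ lpBall p x r}} := by
    simp only [← hsec]
    exact measurable_measure_prodMk_left (e.symm.measurable hAm)
  rw [Measure.real, hEq, ← integral_toReal hmeas.aemeasurable (ae_of_all _ fun x => measure_lt_top _ _)]
  exact integral_congr_ae (ae_of_all _ fun x =>
    pi_real_le_ncard (densityMeasure f) M k (measurableSet_lpBall p x r))

end KNN

/-! ### Layer-cake formula for a truncated logarithm -/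

lemma lintegral_indicator_inv {ρ a : ℝ} (hρ : 0 < ρ) (ha : 0 < a) :
    ∫⁻ r in Set.Ioc 0 a, (Set.Ici ρ).indicator (fun r => ENNReal.ofReal r⁻¹) r =
      ENNReal.ofReal (if ρ ≤ a then Real.log a - Real.log ρ else 0) := by
  rw [lintegral_indicator measurableSet_Ici, Measure.restrict_restrict measurableSet_Ici]
  split_ifs with h
  · have : Set.Ici ρ ∩ Set.Ioc 0 a = Set.Icc ρ a := by
      ext r; simp only [Set.mem_inter_iff, Set.mem_Ici, Set.mem_Ioc, Set.mem_Icc]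
      exact ⟨fun h => ⟨h.1, h.2.2⟩, fun h => ⟨h.1, hρ.trans_le h.1, h.2⟩⟩
    rw [this, ← ofReal_integral_eq_lintegral_ofReal, integral_Icc_eq_integral_Ioc,
      ← intervalIntegral.integral_of_le h, integral_inv_of_pos hρ ha, Real.log_div ha.ne' hρ.ne']
    · refine ContinuousOn.integrableOn_Icc (continuousOn_inv₀.mono fun r hr => ?_)
      exact (hρ.trans_le hr.1).ne'
    · filter_upwards [ae_restrict_mem measurableSet_Icc] with r hr
      exact inv_nonneg.2 (hρ.le.trans hr.1)
  · have : Set.Ici ρ ∩ Set.Ioc 0 a = ∅ := by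
      ext r; simp only [Set.mem_inter_iff, Set.mem_Ici, Set.mem_Ioc, Set.mem_empty_iff_false,
        iff_false]
      exact fun hr => h (hr.1.trans hr.2.2)
    simp [this]

/-- Layer-cake formula for the truncated logarithm. -/
lemma integral_truncated_log {Ω : Type*} [MeasurableSpace Ω] (ν : Measure Ω)
    [IsProbabilityMeasure ν] {ρ : Ω → ℝ} (hρ : Measurable ρ) {a K : ℝ} (ha : 0 < a) (hK : ∀ r ∈ Set.Ioc 0 a, ν.real {z | ρ z ≤ r} ≤ K * r) (A D : ℝ) :
    Integrable (fun z => if ρ z ≤ a then A + D * Real.log (ρ z) else 0) ν ∧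
    ∫ z, (if ρ z ≤ a then A + D * Real.log (ρ z) else 0) ∂ν =
      (A + D * Real.log a) * ν.real {z | ρ z ≤ a} -
        D * ∫ r in Set.Ioc 0 a, ν.real {z | ρ z ≤ r} / r := by
  -- Letting `r → 0` in `hK` excludes `ρ ≤ 0`, so the default value of `Real.log` there does not
  -- matter.
  have hpos : ∀ᵐ z ∂ν, 0 < ρ z := by
    have h0 : ν.real {z | ρ z ≤ 0} ≤ 0 := by
      have hl : Filter.Tendsto (fun r : ℝ => K * r) (nhdsWithin 0 (Set.Ioi 0)) (nhds (K * 0)) :=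
        ((continuous_const.mul continuous_id).tendsto 0).mono_left nhdsWithin_le_nhds
      rw [mul_zero] at hl
      refine ge_of_tendsto hl ?_
      filter_upwards [Ioc_mem_nhdsGT ha] with r hr
      exact (measureReal_mono fun z (hz : ρ z ≤ 0) => hz.trans hr.1.le).trans (hK r hr)
    have h1 : ν {z | ρ z ≤ 0} = 0 :=
      (measureReal_eq_zero_iff).1 (le_antisymm h0 measureReal_nonneg)
    rw [ae_iff]; simpa using h1
  set g : Ω → ℝ := fun z => if ρ z ≤ a then Real.log a - Real.log (ρ z) else 0 with hg
  have hset : MeasurableSet {z | ρ z ≤ a} := hρ measurableSet_Iic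
  have hgm : Measurable g := Measurable.ite hset (by fun_prop) measurable_const
  have hg0 : 0 ≤ᵐ[ν] g := by
    filter_upwards [hpos] with z hz
    simp only [hg, Pi.zero_apply]
    split_ifs with h
    · exact sub_nonneg.2 (Real.log_le_log hz h)
    · exact le_rfl
  have hqm : Measurable fun r => ν.real {z | ρ z ≤ r} :=
    (show Monotone fun r => ν.real {z | ρ z ≤ r} from
      fun r s hrs => measureReal_mono fun z hz => le_trans hz hrs).measurable
  have hq : IntegrableOn (fun r => ν.real {z | ρ z ≤ r} / r) (Set.Ioc 0 a) := by
    refine Integrable.of_bound (C := K) (hqm.div measurable_id).aestronglyMeasurable ?_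
    filter_upwards [ae_restrict_mem measurableSet_Ioc] with r hr
    rw [Real.norm_eq_abs, abs_of_nonneg (div_nonneg measureReal_nonneg hr.1.le), div_le_iff₀ hr.1]
    exact hK r hr
  have hq0 : 0 ≤ᵐ[volume.restrict (Set.Ioc 0 a)] fun r => ν.real {z | ρ z ≤ r} / r := by
    filter_upwards [ae_restrict_mem measurableSet_Ioc] with r hr
    exact div_nonneg measureReal_nonneg hr.1.le
  have hswap : ∫⁻ z, ENNReal.ofReal (g z) ∂ν =
      ENNReal.ofReal (∫ r in Set.Ioc 0 a, ν.real {z | ρ z ≤ r} / r) := by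
    calc ∫⁻ z, ENNReal.ofReal (g z) ∂ν
        = ∫⁻ z, (∫⁻ r in Set.Ioc 0 a,
            (Set.Ici (ρ z)).indicator (fun r => ENNReal.ofReal r⁻¹) r) ∂ν := by
          refine lintegral_congr_ae ?_
          filter_upwards [hpos] with z hz
          rw [lintegral_indicator_inv hz ha]
      _ = ∫⁻ r in Set.Ioc 0 a, (∫⁻ z,
            (Set.Ici (ρ z)).indicator (fun r => ENNReal.ofReal r⁻¹) r ∂ν) := by
          refine lintegral_lintegral_swap (Measurable.aemeasurable ?_)
          have : (Function.uncurry fun z => (Set.Ici (ρ z)).indicator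
              (fun r : ℝ => ENNReal.ofReal r⁻¹)) =
              {q : Ω × ℝ | ρ q.1 ≤ q.2}.indicator fun q => ENNReal.ofReal q.2⁻¹ := by
            ext ⟨z, r⟩; simp [Set.indicator]
          rw [this]
          exact Measurable.indicator (by fun_prop)
            (measurableSet_le (hρ.comp measurable_fst) measurable_snd)
      _ = ∫⁻ r in Set.Ioc 0 a, ENNReal.ofReal (ν.real {z | ρ z ≤ r} / r) := by
          refine setLIntegral_congr_fun measurableSet_Ioc fun r hr => ?_
          have : (fun z => (Set.Ici (ρ z)).indicator (fun r => ENNReal.ofReal r⁻¹) r) =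
              {z | ρ z ≤ r}.indicator fun _ => ENNReal.ofReal r⁻¹ := by
            ext z; simp [Set.indicator]
          have hset_r : MeasurableSet {z | ρ z ≤ r} := hρ measurableSet_Iic
          simp only [this]
          rw [lintegral_indicator_const hset_r, div_eq_inv_mul,
            ENNReal.ofReal_mul (inv_nonneg.2 hr.1.le), ofReal_measureReal]
      _ = _ := (ofReal_integral_eq_lintegral_ofReal hq hq0).symm
  have hgi : Integrable g ν := by
    refine ⟨hgm.aestronglyMeasurable, ?_⟩
    rw [hasFiniteIntegral_iff_ofReal hg0, hswap]
    exact ENNReal.ofReal_lt_top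
  have hgint : ∫ z, g z ∂ν = ∫ r in Set.Ioc 0 a, ν.real {z | ρ z ≤ r} / r := by
    rw [integral_eq_lintegral_of_nonneg_ae hg0 hgm.aestronglyMeasurable, hswap,
      ENNReal.toReal_ofReal (integral_nonneg_of_ae hq0)]
  -- On `ρ ≤ a`, `A + D log ρ` is its value at `a` minus `D (log a - log ρ)`; the last factor is
  -- nonnegative, so Tonelli applies to it.
  have hdecomp : (fun z => if ρ z ≤ a then A + D * Real.log (ρ z) else 0) =
      fun z => {z | ρ z ≤ a}.indicator (fun _ => A + D * Real.log a) z - D * g z := by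
    ext z
    by_cases h : ρ z ≤ a
    · simp only [hg, h, if_true, Set.indicator, Set.mem_ofPred_eq]; ring
    · simp [hg, h]
  have hci : Integrable ({z | ρ z ≤ a}.indicator fun _ => A + D * Real.log a) ν :=
    (integrable_const _).indicator hset
  rw [hdecomp]
  refine ⟨hci.sub (hgi.const_mul D), ?_⟩
  rw [integral_sub hci (hgi.const_mul D), integral_const_mul, hgint, integral_indicator_const _ hset,
    smul_eq_mul, mul_comm]

/-! ### The bias at a fixed truncation radius -/

section Bias

variable {d M k : ℕ} {f : EuclideanSpace ℝ (Fin d) → ℝ} (p : ℝ≥0∞) [Fact (1 ≤ p)]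

/-- The probability that the `k`-th nearest neighbour among `M` points is within distance `r`. -/
noncomputable def knnCDF (p : ℝ≥0∞) [Fact (1 ≤ p)] (M k : ℕ) (f : EuclideanSpace ℝ (Fin d) → ℝ)
    (r : ℝ) : ℝ :=
  ∫ x, binomTail M k ((densityMeasure f).real (lpBall p x r)) ∂densityMeasure f

lemma IsDensity.real_mem_Icc (hf : IsDensity f) (s : Set (EuclideanSpace ℝ (Fin d))) :
    (densityMeasure f).real s ∈ Set.Icc (0 : ℝ) 1 := by
  have := hf.isProbabilityMeasure
  exact ⟨measureReal_nonneg, measureReal_le_one⟩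

lemma integrable_binomTail_lpBall (hf : IsDensity f) (hkM : k ≤ M) (r : ℝ) :
    Integrable (fun x => binomTail M k ((densityMeasure f).real (lpBall p x r)))
      (densityMeasure f) := by
  have := hf.isProbabilityMeasure
  refine Integrable.of_bound (C := 1) ((continuous_binomTail M k).measurable.comp
    (measurable_densityMeasure_lpBall p hf r)).aestronglyMeasurable (ae_of_all _ fun x => ?_)
  have h := hf.real_mem_Icc (lpBall p x r)
  rw [Real.norm_eq_abs, abs_of_nonneg (binomTail_nonneg M k h)]
  exact binomTail_le_one hkM h

/-- Used only for integrability of `F(r)/r` near `0`, so the growth of the constant with `M` is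
harmless. -/
lemma knnCDF_le (hd : 1 ≤ d) (hf : IsDensity f) {Ca : ℝ} (hCa : ∀ᵐ x, f x ≤ Ca) (hCa0 : 0 ≤ Ca)
    (hk : 1 ≤ k) (hkM : k ≤ M) {r : ℝ} (hr : 0 < r) (hr1 : r ≤ 1) :
    knnCDF p M k f r ≤ M * (Ca * unitBallVolume d p) * r := by
  have := hf.isProbabilityMeasure
  have hc := (unitBallVolume_pos (d := d) p).le
  have h : ∀ x, binomTail M k ((densityMeasure f).real (lpBall p x r)) ≤
      M * (Ca * unitBallVolume d p) * r := by
    intro x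
    have hm := hf.real_mem_Icc (lpBall p x r)
    have h1 := abs_binomTail_sub_le hk hkM hm (Set.left_mem_Icc.2 zero_le_one)
    rw [binomTail_zero hk, sub_zero, sub_zero, abs_of_nonneg hm.1] at h1
    have h2 : (densityMeasure f).real (lpBall p x r) ≤ Ca * (unitBallVolume d p * r ^ d) := by
      refine ENNReal.toReal_le_of_le_ofReal (by positivity) ?_
      refine (densityMeasure_le hCa (measurableSet_lpBall p x r)).trans_eq ?_
      rw [volume_lpBall p x hr, ENNReal.ofReal_mul hCa0]
    have h3 : r ^ d ≤ r := pow_le_of_le_one hr.le hr1 (by omega)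
    calc _ ≤ M * (densityMeasure f).real (lpBall p x r) := (le_abs_self _).trans h1
      _ ≤ M * (Ca * (unitBallVolume d p * r)) := by
          gcongr; exact h2.trans (by gcongr)
      _ = _ := by ring
  refine (integral_mono (integrable_binomTail_lpBall p hf hkM r) (integrable_const _) h).trans ?_
  simp

/-- The idealised model, in which a ball around `x` has mass exactly `f x * c * r ^ d`. Fubini
reduces it to `integral_binomTail_div` at each `x`. -/
lemma integral_binomTail_uniform {c : ℝ} (hd : 1 ≤ d) (hf : IsDensity f) {Ca C0 : ℝ}
    (hfC : ∀ᵐ x ∂densityMeasure f, C0 ≤ f x ∧ f x ≤ Ca) (hC0 : 0 < C0) (hc : 0 < c)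
    (hk : 1 ≤ k) (hkM : k ≤ M) {a : ℝ} (ha : 0 < a) (ha1 : a ≤ 1) (hCa1 : Ca * c * a ^ d ≤ 1) :
    IntegrableOn (fun r => (∫ x, binomTail M k (f x * c * r ^ d) ∂densityMeasure f) / r)
      (Set.Ioc 0 a) ∧
    Integrable (fun x => binomTailPrimitive M k (f x * c * a ^ d)) (densityMeasure f) ∧
    d * ∫ r in Set.Ioc 0 a, (∫ x, binomTail M k (f x * c * r ^ d) ∂densityMeasure f) / r =
      ∫ x, binomTailPrimitive M k (f x * c * a ^ d) ∂densityMeasure f := by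
  have := hf.isProbabilityMeasure
  have hx1 : ∀ x, f x ≤ Ca → f x * c * a ^ d ≤ 1 := fun x hx => le_trans (by gcongr) hCa1
  have hint : Integrable (Function.uncurry fun (r : ℝ) x => binomTail M k (f x * c * r ^ d) / r)
      ((volume.restrict (Set.Ioc 0 a)).prod (densityMeasure f)) := by
    refine Integrable.of_bound (C := M * (Ca * c)) (Measurable.aestronglyMeasurable ?_) ?_
    · have := hf.measurable
      have := (continuous_binomTail M k).measurable
      simp only [Function.uncurry_def]
      fun_prop
    · have h1 := (Measure.quasiMeasurePreserving_fst (μ := volume.restrict (Set.Ioc 0 a))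
        (ν := densityMeasure f)).ae (ae_restrict_mem measurableSet_Ioc)
      have h2 := (Measure.quasiMeasurePreserving_snd (μ := volume.restrict (Set.Ioc 0 a))
        (ν := densityMeasure f)).ae hfC
      filter_upwards [h1, h2] with ⟨r, x⟩ hr hx
      simp only [Function.uncurry_apply_pair] at hr hx ⊢
      have hs : 0 < f x * c := mul_pos (hC0.trans_le hx.1) hc
      have h3 := binomTail_div_mem_Icc hk hkM hd hs ha1 (hx1 x hx.2) r hr
      rw [Real.norm_eq_abs, abs_of_nonneg h3.1]
      refine h3.2.trans ?_
      gcongr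
      exact hx.2
  have hJ : (fun x => (d : ℝ) * ∫ r in Set.Ioc 0 a, binomTail M k (f x * c * r ^ d) / r)
      =ᵐ[densityMeasure f] fun x => binomTailPrimitive M k (f x * c * a ^ d) := by
    filter_upwards [hfC] with x hx
    exact integral_binomTail_div hk hkM hd (mul_pos (hC0.trans_le hx.1) hc) ha ha1 (hx1 x hx.2)
  refine ⟨?_, ?_, ?_⟩
  · have := hint.integral_prod_left
    simpa only [IntegrableOn, Function.uncurry_apply_pair, integral_div] using this
  · exact (hint.integral_prod_right.const_mul (d : ℝ)).congr hJ
  · rw [← integral_congr_ae hJ, integral_const_mul]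
    congr 1
    rw [← integral_integral_swap hint]
    simp only [integral_div]

/-- Deterministic form of the bias bound, with an arbitrary truncation level `a`. -/
lemma abs_bias_le (hd : 1 ≤ d) (hf : IsDensity f) {Ca C0 K ε a B : ℝ}
    (hfC : ∀ᵐ x ∂densityMeasure f, C0 ≤ f x ∧ f x ≤ Ca) (hfCv : ∀ᵐ x, f x ≤ Ca)
    (hC0 : 0 < C0) (hCa : 0 < Ca) (hK0 : 0 < K)
    (hK : ∀ r : ℝ, 0 < r → r ≤ 1 →
      Integrable (fun x => (densityMeasure f).real (lpBall p x r) -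
        f x * (unitBallVolume d p * r ^ d)) (densityMeasure f) ∧
      ∫ x, |(densityMeasure f).real (lpBall p x r) - f x * (unitBallVolume d p * r ^ d)|
        ∂densityMeasure f ≤ K * r ^ (d + 1))
    (hk : 1 ≤ k) (hkM : k ≤ M) (ha : 0 < a) (ha1 : a ≤ 1)
    (hCa1 : Ca * unitBallVolume d p * a ^ d ≤ 1)
    (hε : 1 - binomTail M k (C0 * unitBallVolume d p * a ^ d / 2) ≤ ε) :
    |B * knnCDF p M k f a - d * (∫ r in Set.Ioc 0 a, knnCDF p M k f r / r) - entropy f -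
        (B - Real.log (unitBallVolume d p) - d * Real.log a - (harmonic M - harmonic (k - 1) : ℚ))| ≤
      |B| * (ε + K * a ^ (d + 1) / (C0 * unitBallVolume d p * a ^ d / 2)) +
        ε / (C0 * unitBallVolume d p * a ^ d) + d * (M * K * a ^ (d + 1)) := by
  have := hf.isProbabilityMeasure
  have hc := unitBallVolume_pos (d := d) p
  set c := unitBallVolume d p with hcdef
  -- Half of the least idealised mass of a ball of radius `a` centred in the support; the margin of
  -- a factor two is used in `hE3`.
  set u₀ := C0 * c * a ^ d / 2 with hu₀
  have hu₀0 : 0 < u₀ := by positivity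
  have hC0a : C0 ≤ Ca := by
    obtain ⟨x, hx⟩ := hfC.exists
    exact hx.1.trans hx.2
  have hu₀1 : u₀ ≤ 1 := by
    have : C0 * c * a ^ d ≤ Ca * c * a ^ d := by gcongr
    linarith
  have hu₀m : u₀ ∈ Set.Icc (0 : ℝ) 1 := ⟨hu₀0.le, hu₀1⟩
  have hε0 : 0 ≤ ε := le_trans (by linarith [binomTail_le_one hkM hu₀m]) hε
  obtain ⟨hi0, hiJ, hJ⟩ := integral_binomTail_uniform hd hf hfC hC0 hc hk hkM ha ha1 hCa1
  set p₀ : ℝ → ℝ := fun r => ∫ x, binomTail M k (f x * c * r ^ d) ∂densityMeasure f with hp₀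
  have hdiff : ∀ r ∈ Set.Ioc 0 a, |knnCDF p M k f r - p₀ r| ≤ M * K * r ^ (d + 1) := by
    intro r hr
    obtain ⟨hKi, hKr⟩ := hK r hr.1 (hr.2.trans ha1)
    have hmem : ∀ᵐ x ∂densityMeasure f, f x * c * r ^ d ∈ Set.Icc (0 : ℝ) 1 := by
      filter_upwards [hfC] with x hx
      have := hr.1.le
      have := hf.nonneg x
      refine ⟨by positivity, le_trans ?_ hCa1⟩
      gcongr
      · exact hx.2
      · exact hr.2
    have hi : Integrable (fun x => binomTail M k (f x * c * r ^ d)) (densityMeasure f) := by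
      refine Integrable.of_bound (C := 1) ((continuous_binomTail M k).measurable.comp
        ((hf.measurable.mul_const _).mul_const _)).aestronglyMeasurable ?_
      filter_upwards [hmem] with x hx
      rw [Real.norm_eq_abs, abs_of_nonneg (binomTail_nonneg M k hx)]
      exact binomTail_le_one hkM hx
    rw [knnCDF, hp₀]
    simp only
    rw [← integral_sub (integrable_binomTail_lpBall p hf hkM r) hi]
    refine (abs_integral_le_integral_abs).trans ?_
    calc _ ≤ ∫ x, M * |(densityMeasure f).real (lpBall p x r) - f x * (c * r ^ d)|
          ∂densityMeasure f := by
          refine integral_mono_ae ((integrable_binomTail_lpBall p hf hkM r).sub hi).abs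
            (hKi.abs.const_mul _) ?_
          filter_upwards [hmem] with x hx
          rw [← mul_assoc]
          exact abs_binomTail_sub_le hk hkM (hf.real_mem_Icc _) hx
      _ ≤ M * (K * r ^ (d + 1)) := by
          rw [integral_const_mul]; gcongr
      _ = _ := by ring
  have hcdfm : Measurable (knnCDF p M k f) := by
    have hmono : MonotoneOn (knnCDF p M k f) Set.univ := by
      intro r _ s _ hrs
      refine integral_mono (integrable_binomTail_lpBall p hf hkM r)
        (integrable_binomTail_lpBall p hf hkM s) fun x => ?_
      exact monotoneOn_binomTail hk hkM (hf.real_mem_Icc _) (hf.real_mem_Icc _)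
        (measureReal_mono fun y hy => le_trans hy hrs)
    exact (monotoneOn_univ.1 hmono).measurable
  have hi1 : IntegrableOn (fun r => knnCDF p M k f r / r) (Set.Ioc 0 a) := by
    refine Integrable.of_bound (C := M * (Ca * c))
      (hcdfm.div measurable_id).aestronglyMeasurable ?_
    filter_upwards [ae_restrict_mem measurableSet_Ioc] with r hr
    have h0 : 0 ≤ knnCDF p M k f r :=
      integral_nonneg fun x => binomTail_nonneg M k (hf.real_mem_Icc _)
    rw [Real.norm_eq_abs, abs_of_nonneg (div_nonneg h0 hr.1.le), div_le_iff₀ hr.1]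
    exact knnCDF_le p hd hf hfCv hCa.le hk hkM hr.1 (hr.2.trans ha1)
  -- Dividing by `r` costs one power of `r`, and integrating over `(0, a]` restores it.
  have hE1 : |(∫ r in Set.Ioc 0 a, knnCDF p M k f r / r) - ∫ r in Set.Ioc 0 a, p₀ r / r| ≤
      M * K * a ^ (d + 1) := by
    rw [← integral_sub hi1 hi0]
    have hb : ∀ r ∈ Set.Ioc 0 a, ‖knnCDF p M k f r / r - p₀ r / r‖ ≤ M * K * a ^ d := by
      intro r hr
      rw [← sub_div, Real.norm_eq_abs, abs_div, abs_of_pos hr.1, div_le_iff₀ hr.1]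
      refine (hdiff r hr).trans ?_
      rw [pow_succ, ← mul_assoc]
      have := hr.1.le
      gcongr
      exact hr.2
    have h := norm_setIntegral_le_of_norm_le_const (μ := volume) (s := Set.Ioc 0 a) (by simp) hb
    rw [Real.norm_eq_abs, Real.volume_real_Ioc_of_le ha.le, sub_zero] at h
    refine h.trans_eq ?_
    rw [pow_succ]; ring
  have hlogi : Integrable (fun x => Real.log (f x * c * a ^ d)) (densityMeasure f) := by
    refine Integrable.of_bound (C := |Real.log (C0 * c * a ^ d)| + |Real.log (Ca * c * a ^ d)|)
      (Real.measurable_log.comp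
        ((hf.measurable.mul_const _).mul_const _)).aestronglyMeasurable ?_
    filter_upwards [hfC] with x hx
    have hx0 : 0 < f x := hC0.trans_le hx.1
    have h1 : Real.log (C0 * c * a ^ d) ≤ Real.log (f x * c * a ^ d) := by
      gcongr; exact hx.1
    have h2 : Real.log (f x * c * a ^ d) ≤ Real.log (Ca * c * a ^ d) := by
      gcongr; exact hx.2
    rw [Real.norm_eq_abs, abs_le]
    have := neg_abs_le (Real.log (C0 * c * a ^ d))
    have := le_abs_self (Real.log (Ca * c * a ^ d))
    have := abs_nonneg (Real.log (C0 * c * a ^ d))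
    have := abs_nonneg (Real.log (Ca * c * a ^ d))
    constructor <;> linarith
  have hlog : ∫ x, Real.log (f x * c * a ^ d) ∂densityMeasure f =
      -entropy f + Real.log c + d * Real.log a := by
    have hae : (fun x => Real.log (f x * c * a ^ d) - (Real.log c + d * Real.log a))
        =ᵐ[densityMeasure f] fun x => Real.log (f x) := by
      filter_upwards [hfC] with x hx
      have hx0 : 0 < f x := hC0.trans_le hx.1
      rw [Real.log_mul (by positivity) (by positivity), Real.log_mul hx0.ne' hc.ne', Real.log_pow]
      ring
    have h1 := integral_congr_ae hae
    rw [integral_sub hlogi (integrable_const _), integral_const, probReal_univ, one_smul,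
      hf.integral_densityMeasure (fun x => Real.log (f x))] at h1
    rw [entropy]
    linarith
  have hE2 : |(harmonic M - harmonic (k - 1) : ℚ) - (∫ x, binomTailPrimitive M k (f x * c * a ^ d)
      ∂densityMeasure f) + ∫ x, Real.log (f x * c * a ^ d) ∂densityMeasure f| ≤
      ε / (C0 * c * a ^ d) := by
    have hh : (((harmonic M - harmonic (k - 1) : ℚ)) : ℝ) =
        ∫ _, binomTailPrimitive M k 1 ∂densityMeasure f := by
      rw [integral_const, probReal_univ, one_smul, binomTailPrimitive_one hk hkM]; push_cast; rfl
    have hJi : Integrable (fun x => binomTailPrimitive M k 1 -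
        binomTailPrimitive M k (f x * c * a ^ d)) (densityMeasure f) := (integrable_const _).sub hiJ
    rw [hh, ← integral_sub (integrable_const _) hiJ, ← integral_add hJi hlogi]
    have hb : ∀ᵐ x ∂densityMeasure f, ‖binomTailPrimitive M k 1 -
        binomTailPrimitive M k (f x * c * a ^ d) + Real.log (f x * c * a ^ d)‖ ≤
        ε / (C0 * c * a ^ d) := by
      filter_upwards [hfC] with x hx
      have hx0 : 0 < f x := hC0.trans_le hx.1
      have hw1 : f x * c * a ^ d ≤ 1 := le_trans (by gcongr; exact hx.2) hCa1
      have hlow : C0 * c * a ^ d ≤ f x * c * a ^ d := by gcongr; exact hx.1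
      refine (abs_binomTailPrimitive_add_log_le hk hkM (by positivity) hw1).trans ?_
      refine div_le_div₀ hε0 ?_ (by positivity) hlow
      have hmn := monotoneOn_binomTail hk hkM hu₀m
        (show f x * c * a ^ d ∈ Set.Icc (0 : ℝ) 1 from ⟨by positivity, hw1⟩)
        (by rw [hu₀]; have : 0 < C0 * c * a ^ d := by positivity
            linarith)
      linarith
    have h := norm_integral_le_of_norm_le_const hb
    rwa [probReal_univ, mul_one] at h
  -- If the ball mass is at least `u₀`, the tail falls short of `1` by at most `ε`. Otherwise the
  -- mass differs from its idealisation by at least `u₀`, and Markov's inequality with the ball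
  -- error bounds how often this occurs.
  have hE3 : |1 - knnCDF p M k f a| ≤ ε + K * a ^ (d + 1) / u₀ := by
    obtain ⟨hKi, hKa⟩ := hK a ha ha1
    have hii := integrable_binomTail_lpBall (M := M) (k := k) p hf hkM a
    have h1 : 1 - knnCDF p M k f a =
        ∫ x, (1 - binomTail M k ((densityMeasure f).real (lpBall p x a))) ∂densityMeasure f := by
      rw [integral_sub (integrable_const _) hii, integral_const, probReal_univ, one_smul, knnCDF]
    rw [h1, abs_of_nonneg (integral_nonneg fun x => sub_nonneg.2
      (binomTail_le_one hkM (hf.real_mem_Icc _)))]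
    calc _ ≤ ∫ x, (ε + |(densityMeasure f).real (lpBall p x a) - f x * (c * a ^ d)| / u₀)
          ∂densityMeasure f := by
          refine integral_mono_ae ((integrable_const _).sub hii)
            ((integrable_const _).add (hKi.abs.div_const _)) ?_
          filter_upwards [hfC] with x hx
          have hm := hf.real_mem_Icc (lpBall p x a)
          rcases le_or_gt u₀ ((densityMeasure f).real (lpBall p x a)) with h | h
          · have hmn := monotoneOn_binomTail hk hkM hu₀m hm h
            have : 0 ≤ |(densityMeasure f).real (lpBall p x a) - f x * (c * a ^ d)| / u₀ := by
              positivity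
            linarith
          · have hlow : C0 * c * a ^ d ≤ f x * (c * a ^ d) := by
              rw [mul_assoc]; gcongr; exact hx.1
            have : 1 ≤ |(densityMeasure f).real (lpBall p x a) - f x * (c * a ^ d)| / u₀ := by
              rw [one_le_div hu₀0, abs_sub_comm]
              refine le_trans ?_ (le_abs_self _)
              rw [hu₀] at h ⊢
              linarith
            have := binomTail_nonneg M k hm
            linarith
      _ = ε + (∫ x, |(densityMeasure f).real (lpBall p x a) - f x * (c * a ^ d)|
          ∂densityMeasure f) / u₀ := by
          rw [integral_add (integrable_const _) (hKi.abs.div_const _), integral_const,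
            probReal_univ, one_smul, integral_div]
      _ ≤ _ := by gcongr
  set I₁ := ∫ r in Set.Ioc 0 a, knnCDF p M k f r / r
  set I₂ := ∫ r in Set.Ioc 0 a, p₀ r / r
  set I₃ := ∫ x, binomTailPrimitive M k (f x * c * a ^ d) ∂densityMeasure f
  have hJ' : (d : ℝ) * I₂ = I₃ := hJ
  rw [hlog] at hE2
  set h : ℝ := ((harmonic M - harmonic (k - 1) : ℚ) : ℝ)
  -- The three summands are the loss by truncation (`hE3`), the idealised integral against the
  -- logarithm (`hE2`), and the replacement of ball masses (`hE1`).
  have hsplit : B * knnCDF p M k f a - d * I₁ - entropy f -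
      (B - Real.log c - d * Real.log a - h) =
      -(B * (1 - knnCDF p M k f a)) + (h - I₃ + (-entropy f + Real.log c + d * Real.log a)) -
        d * (I₁ - I₂) := by
    rw [← hJ']; ring
  rw [hsplit]
  refine (abs_sub _ _).trans (add_le_add ((abs_add_le _ _).trans (add_le_add ?_ hE2)) ?_)
  · rw [abs_neg, abs_mul]; gcongr
  · rw [abs_mul, Nat.abs_cast]; gcongr

end Bias

/-! ### Harmonic numbers, the threshold and the rate -/

lemma digamma_natCast {k : ℕ} (hk : 1 ≤ k) :
    digamma k = (harmonic (k - 1) : ℝ) - Real.eulerMascheroniConstant := by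
  obtain ⟨k, rfl⟩ := Nat.exists_eq_add_of_le' hk
  rw [digamma, logDeriv_apply, Nat.cast_add_one, Real.deriv_Gamma_nat, Real.Gamma_nat_eq_factorial,
    Nat.add_sub_cancel, mul_div_cancel_left₀ _ (by positivity)]
  ring

/-- Euler's constant lies between `H_M - log (M+1)` and `H_M - log M`, and these differ by at most
`1/M`. -/
lemma abs_log_add_eulerMascheroni_sub_harmonic_le {M : ℕ} (hM : 1 ≤ M) :
    |Real.log ((M + 1 : ℕ) : ℝ) + Real.eulerMascheroniConstant - (harmonic M : ℝ)| ≤ 1 / M := by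
  have h1 := Real.eulerMascheroniSeq_lt_eulerMascheroniConstant M
  have h2 := Real.eulerMascheroniConstant_lt_eulerMascheroniSeq' M
  rw [Real.eulerMascheroniSeq] at h1
  rw [Real.eulerMascheroniSeq', if_neg (by omega)] at h2
  have hM0 : (0 : ℝ) < M := by exact_mod_cast hM
  have h3 : Real.log (M + 1) - Real.log M ≤ 1 / M := by
    rw [← Real.log_div (by positivity) hM0.ne']
    refine (Real.log_le_sub_one_of_pos (by positivity)).trans_eq ?_
    field_simp; ring
  push_cast
  rw [abs_of_nonneg (by linarith)]
  linarith

lemma threshold_pow {d N : ℕ} (hd : 1 ≤ d) {δ : ℝ} (hN : 1 ≤ N) :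
    threshold d N δ ^ d = Real.log N ^ (1 + δ) / N := by
  have h : 0 ≤ Real.log N ^ (1 + δ) / N := by
    have : 0 ≤ Real.log N := Real.log_natCast_nonneg N
    positivity
  rw [threshold, ← Real.rpow_natCast, ← Real.rpow_mul h, one_div,
    inv_mul_cancel₀ (by exact_mod_cast (by omega : d ≠ 0)), Real.rpow_one]

/-- With `(log N)^(1+δ) = N a^d` for the threshold `a`, the rate is `N a^(d+1)`, the form in which
the error terms appear. -/
lemma rate_eq {d N : ℕ} {δ : ℝ} (hN : 1 < N) :
    Real.log N ^ ((1 + δ) * (1 + 1 / (d : ℝ))) / (N : ℝ) ^ (1 / (d : ℝ)) =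
      Real.log N ^ (1 + δ) * threshold d N δ := by
  have h0 : 0 < Real.log N := Real.log_pos (by exact_mod_cast hN)
  rw [threshold, Real.div_rpow (by positivity) (by positivity), ← Real.rpow_mul h0.le, mul_add,
    mul_one, Real.rpow_add h0, mul_div_assoc]

lemma eventually_large_sample (δ κ A c : ℝ) (hδ : 0 < δ) (hκ : 0 < κ) (hA : 0 < A) :
    ∀ᶠ N : ℕ in Filter.atTop, c * (Real.log N ^ (1 + δ) / N) ≤ 1 ∧ 1 ≤ Real.log N ∧
      A * Real.exp (-(κ * Real.log N ^ (1 + δ))) ≤ 1 / (N : ℝ) ^ 2 := by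
  have hlog : Filter.Tendsto (fun N : ℕ => Real.log N) Filter.atTop Filter.atTop :=
    Real.tendsto_log_atTop.comp tendsto_natCast_atTop_atTop
  have h1 : Filter.Tendsto (fun N : ℕ => c * (Real.log N ^ (1 + δ) / N)) Filter.atTop
      (nhds (c * 0)) := by
    have h := (isLittleO_log_rpow_rpow_atTop (1 + δ) (zero_lt_one' ℝ)).tendsto_div_nhds_zero
    simp only [Real.rpow_one] at h
    exact (h.comp tendsto_natCast_atTop_atTop).const_mul c
  rw [mul_zero] at h1
  have h2 : Filter.Tendsto (fun N : ℕ => κ * Real.log N ^ δ) Filter.atTop Filter.atTop :=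
    ((tendsto_rpow_atTop hδ).comp hlog).const_mul_atTop hκ
  -- As `δ > 0`, the exponent `κ (log N)^δ log N` eventually exceeds `3 log N`: two parts give
  -- `N⁻²`, the third absorbs `A`.
  filter_upwards [h1.eventually_le_const zero_lt_one, hlog.eventually_ge_atTop 1,
    hlog.eventually_ge_atTop (Real.log A), h2.eventually_ge_atTop 3,
    Filter.eventually_ge_atTop 1] with N e1 e2 e3 e4 e5
  refine ⟨e1, e2, ?_⟩
  have hN : (0 : ℝ) < N := by exact_mod_cast e5
  have hl : 0 < Real.log N := by linarith
  have hexp : 1 / (N : ℝ) ^ 2 = Real.exp (-(2 * Real.log N)) := by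
    rw [Real.exp_neg, two_mul, Real.exp_add, Real.exp_log hN, one_div, sq]
  rw [hexp, ← Real.exp_log hA, ← Real.exp_add]
  refine Real.exp_le_exp.2 ?_
  rw [Real.rpow_add hl, Real.rpow_one]
  nlinarith

/-! ### Expectation of the estimator and the final bound -/

section Main

variable {d k : ℕ} (p : ℝ≥0∞) [Fact (1 ≤ p)]

/-- Expectation of a local estimate under the product measure. -/
lemma integral_localEstimate {M : ℕ} {f : EuclideanSpace ℝ (Fin d) → ℝ} (hd : 1 ≤ d)
    (hf : IsDensity f) {Ca : ℝ} (hCa : ∀ᵐ x, f x ≤ Ca) (hCa0 : 0 ≤ Ca) (hk : 1 ≤ k) (hkM : k ≤ M)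
    {δ : ℝ} (ha : 0 < threshold d (M + 1) δ) (ha1 : threshold d (M + 1) δ ≤ 1) (i : Fin (M + 1)) :
    Integrable (fun x => localEstimate p k δ x i)
      (Measure.pi fun _ : Fin (M + 1) => densityMeasure f) ∧
    ∫ x, localEstimate p k δ x i ∂(Measure.pi fun _ : Fin (M + 1) => densityMeasure f) =
      (-digamma k + Real.log ((M + 1 : ℕ) : ℝ) + Real.log (unitBallVolume d p) +
        d * Real.log (threshold d (M + 1) δ)) * knnCDF p M k f (threshold d (M + 1) δ) -
      d * ∫ r in Set.Ioc 0 (threshold d (M + 1) δ), knnCDF p M k f r / r := by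
  have := hf.isProbabilityMeasure
  have hcdf : ∀ r, 0 ≤ r → (Measure.pi fun _ : Fin (M + 1) => densityMeasure f).real
      {x | knnDist p k x i ≤ r} = knnCDF p M k f r := fun r hr =>
    pi_real_knnDist_le p hf hkM i hr
  obtain ⟨h1, h2⟩ := integral_truncated_log (Measure.pi fun _ : Fin (M + 1) => densityMeasure f)
    (measurable_knnDist p hkM i) ha (K := M * (Ca * unitBallVolume d p))
    (fun r hr => by
      rw [hcdf r hr.1.le]
      exact knnCDF_le p hd hf hCa hCa0 hk hkM hr.1 (hr.2.trans ha1))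
    (-digamma k + Real.log ((M + 1 : ℕ) : ℝ) + Real.log (unitBallVolume d p)) d
  refine ⟨h1, h2.trans ?_⟩
  rw [hcdf _ ha.le]
  congr 2
  exact setIntegral_congr_fun measurableSet_Ioc fun r hr => by simp only [hcdf r hr.1.le]

/-- The local estimates are dependent, but linearity of expectation needs only that they have the
same mean. -/
lemma integral_truncatedKL {M : ℕ} {f : EuclideanSpace ℝ (Fin d) → ℝ} (hd : 1 ≤ d)
    (hf : IsDensity f) {Ca : ℝ} (hCa : ∀ᵐ x, f x ≤ Ca) (hCa0 : 0 ≤ Ca) (hk : 1 ≤ k) (hkM : k ≤ M)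
    {δ : ℝ} (ha : 0 < threshold d (M + 1) δ) (ha1 : threshold d (M + 1) δ ≤ 1)
    {Ω : Type*} [MeasurableSpace Ω] (P : Measure Ω) [IsProbabilityMeasure P]
    (X : Fin (M + 1) → Ω → EuclideanSpace ℝ (Fin d)) (hX : ∀ i, Measurable (X i))
    (hind : iIndepFun X P) (hlaw : ∀ i, P.map (X i) = densityMeasure f) :
    Integrable (fun ω => truncatedKL p k δ (fun i => X i ω)) P ∧
    ∫ ω, truncatedKL p k δ (fun i => X i ω) ∂P =
      (-digamma k + Real.log ((M + 1 : ℕ) : ℝ) + Real.log (unitBallVolume d p) +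
        d * Real.log (threshold d (M + 1) δ)) * knnCDF p M k f (threshold d (M + 1) δ) -
      d * ∫ r in Set.Ioc 0 (threshold d (M + 1) δ), knnCDF p M k f r / r := by
  have hmap : P.map (fun ω i => X i ω) = Measure.pi fun _ : Fin (M + 1) => densityMeasure f := by
    rw [(iIndepFun_iff_map_fun_eq_pi_map fun i => (hX i).aemeasurable).1 hind]
    simp only [hlaw]
  have hXm : Measurable fun ω i => X i ω := measurable_pi_lambda _ hX
  have hloc := integral_localEstimate p hd hf hCa hCa0 hk hkM ha ha1
  set E := (-digamma k + Real.log ((M + 1 : ℕ) : ℝ) + Real.log (unitBallVolume d p) +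
        d * Real.log (threshold d (M + 1) δ)) * knnCDF p M k f (threshold d (M + 1) δ) -
      d * ∫ r in Set.Ioc 0 (threshold d (M + 1) δ), knnCDF p M k f r / r with hE
  have hint : Integrable (fun x => truncatedKL p k δ x)
      (Measure.pi fun _ : Fin (M + 1) => densityMeasure f) :=
    (integrable_finsetSum _ fun i _ => (hloc i).1).const_mul _
  rw [← hmap] at hint
  refine ⟨hint.comp_measurable hXm, ?_⟩
  have h := integral_map hXm.aemeasurable hint.aestronglyMeasurable
  rw [← h, hmap]
  simp only [truncatedKL]
  rw [integral_const_mul, integral_finsetSum _ fun i _ => (hloc i).1,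
    Finset.sum_congr rfl fun i _ => (hloc i).2, Finset.sum_const, Finset.card_univ,
    Fintype.card_fin, nsmul_eq_mul, ← mul_assoc, one_div_mul_cancel (by positivity), one_mul]

lemma IsDensity.integrable_mul_log {f : EuclideanSpace ℝ (Fin d) → ℝ} (hf : IsDensity f)
    {Ca C0 : ℝ} (hfC : ∀ᵐ x ∂densityMeasure f, C0 ≤ f x ∧ f x ≤ Ca) (hC0 : 0 < C0) :
    Integrable fun x => f x * Real.log (f x) := by
  have := hf.isProbabilityMeasure
  rw [← hf.integrable_densityMeasure_iff fun x => Real.log (f x)]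
  refine Integrable.of_bound (C := |Real.log C0| + |Real.log Ca|)
    (Real.measurable_log.comp hf.measurable).aestronglyMeasurable ?_
  filter_upwards [hfC] with x hx
  have h1 : Real.log C0 ≤ Real.log (f x) := Real.log_le_log hC0 hx.1
  have h2 : Real.log (f x) ≤ Real.log Ca := Real.log_le_log (hC0.trans_le hx.1) hx.2
  rw [Real.norm_eq_abs, abs_le]
  have := neg_abs_le (Real.log C0)
  have := le_abs_self (Real.log Ca)
  have := abs_nonneg (Real.log C0)
  have := abs_nonneg (Real.log Ca)
  constructor <;> linarith

end Main

lemma RegularDensity.bounds_ae {d : ℕ} {f : EuclideanSpace ℝ (Fin d) → ℝ}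
    {Ca Cb Cc Cd Ce C0 : ℝ} (hf : IsDensity f) (hR : RegularDensity f Ca Cb Cc Cd Ce C0) :
    ∀ᵐ x ∂densityMeasure f, C0 ≤ f x ∧ f x ≤ Ca :=
  (hR.le_ae hf).and (densityMeasure_ac.ae_le hR.bounded)

/-- The terms of the bias bound at sample size `M + 1` are all of the order of the rate. -/
lemma bias_terms_le {d M : ℕ} (hd : 1 ≤ d) (hM : 1 ≤ M) {L a c C0 K ψ ε : ℝ} (hL : 1 ≤ L)
    (ha : 0 < a) (ha1 : a ≤ 1) (had : a ^ d = L / (M + 1 : ℕ)) (hc : 0 < c) (hC0 : 0 < C0)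
    (hK : 0 < K) (hε : ε ≤ 1 / ((M + 1 : ℕ) : ℝ) ^ 2) :
    |-ψ + Real.log ((M + 1 : ℕ) : ℝ) + Real.log c + d * Real.log a| *
        (ε + K * a ^ (d + 1) / (C0 * c * a ^ d / 2)) + ε / (C0 * c * a ^ d) +
        d * (M * K * a ^ (d + 1)) + 1 / M ≤
      ((|ψ| + |Real.log c| + 1) * (1 + 2 * K / (C0 * c)) + 1 / (C0 * c) + d * K + 2) *
        (L * a) := by
  set n : ℝ := ((M + 1 : ℕ) : ℝ) with hn
  have hM0 : (1 : ℝ) ≤ M := by exact_mod_cast hM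
  have hnM : n = M + 1 := by rw [hn]; push_cast; rfl
  have hn0 : 0 < n := by linarith
  have hna : 1 / n ≤ a := by
    calc 1 / n ≤ L / n := by gcongr
      _ = a ^ d := had.symm
      _ ≤ a := pow_le_of_le_one ha.le ha1 (by omega)
  have haL : a ≤ L * a := by nlinarith
  have hεa : ε ≤ a := by
    refine hε.trans (le_trans ?_ hna)
    rw [sq, one_div_le_one_div (by positivity) hn0]
    nlinarith
  -- Since `a^d = L/n`, the term `d log a` cancels `log n` and leaves only `log L ≤ L`.
  have hB : |-ψ + Real.log n + Real.log c + d * Real.log a| ≤ (|ψ| + |Real.log c| + 1) * L := by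
    have h1 : d * Real.log a = Real.log L - Real.log n := by
      rw [← Real.log_pow, had, Real.log_div (by positivity) hn0.ne']
    have h2 : -ψ + Real.log n + Real.log c + d * Real.log a = -ψ + Real.log c + Real.log L := by
      rw [h1]; ring
    rw [h2]
    have h3 : |Real.log L| ≤ L := by
      rw [abs_of_nonneg (Real.log_nonneg hL)]
      linarith [Real.log_le_sub_one_of_pos (by linarith : 0 < L)]
    calc |-ψ + Real.log c + Real.log L| ≤ |ψ| + |Real.log c| + |Real.log L| := by
          refine (abs_add_le _ _).trans (add_le_add_left ((abs_add_le _ _).trans_eq ?_) _)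
          rw [abs_neg]
      _ ≤ |ψ| * L + |Real.log c| * L + 1 * L := by
          have := abs_nonneg ψ
          have := abs_nonneg (Real.log c)
          gcongr
          · exact le_mul_of_one_le_right (abs_nonneg _) hL
          · exact le_mul_of_one_le_right (abs_nonneg _) hL
          · linarith
      _ = _ := by ring
  have hK1 : K * a ^ (d + 1) / (C0 * c * a ^ d / 2) = 2 * K / (C0 * c) * a := by
    rw [pow_succ]; field_simp
  have hT1 : |-ψ + Real.log n + Real.log c + d * Real.log a| *
      (ε + K * a ^ (d + 1) / (C0 * c * a ^ d / 2)) ≤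
      (|ψ| + |Real.log c| + 1) * (1 + 2 * K / (C0 * c)) * (L * a) := by
    rw [hK1]
    calc _ ≤ |-ψ + Real.log n + Real.log c + d * Real.log a| * (a + 2 * K / (C0 * c) * a) := by
          gcongr
      _ ≤ ((|ψ| + |Real.log c| + 1) * L) * (a + 2 * K / (C0 * c) * a) := by gcongr
      _ = _ := by ring
  have hT2 : ε / (C0 * c * a ^ d) ≤ 1 / (C0 * c) * (L * a) := by
    rw [div_le_iff₀ (by positivity), had]
    have h1 : 1 / (C0 * c) * (L * a) * (C0 * c * (L / n)) = L * a * (L / n) := by field_simp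
    rw [h1]
    calc ε ≤ 1 / n ^ 2 := hε
      _ = 1 / n * (1 / n) := by rw [sq]; field_simp
      _ ≤ L * a * (L / n) := by
          gcongr
          exact hna.trans haL
  have hT3 : d * (M * K * a ^ (d + 1)) ≤ d * K * (L * a) := by
    have h1 : M * a ^ d ≤ L := by
      rw [had, mul_div_assoc', div_le_iff₀ hn0]
      nlinarith
    calc d * (M * K * a ^ (d + 1)) = d * K * ((M * a ^ d) * a) := by rw [pow_succ]; ring
      _ ≤ d * K * (L * a) := by gcongr
  have hT4 : 1 / (M : ℝ) ≤ 2 * (L * a) := by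
    have h1 : 1 / (M : ℝ) ≤ 2 * (1 / n) := by
      rw [mul_one_div, div_le_div_iff₀ (by linarith) hn0]; linarith
    linarith
  linarith

end KLEntropy

theorem mainTheorem5 (d k : ℕ) (hd : 1 ≤ d) (hk : 1 ≤ k) (p : ℝ≥0∞) [Fact (1 ≤ p)]
    (δ : ℝ) (hδ : 0 < δ) (Ca Cb Cc Cd Ce C0 : ℝ) (hC0 : 0 < C0) :
    ∃ (C : ℝ) (N₀ : ℕ), 0 < C ∧
      ∀ f : EuclideanSpace ℝ (Fin d) → ℝ, KLEntropy.IsDensity f →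
        KLEntropy.RegularDensity f Ca Cb Cc Cd Ce C0 →
        Integrable (fun x => f x * Real.log (f x)) volume ∧
        ∀ N : ℕ, N₀ ≤ N →
        ∀ {Ω : Type*} [MeasurableSpace Ω] (P : Measure Ω) [IsProbabilityMeasure P]
          (X : Fin N → Ω → EuclideanSpace ℝ (Fin d)),
          (∀ i, Measurable (X i)) → iIndepFun X P →
          (∀ i, P.map (X i) = volume.withDensity (fun x => ENNReal.ofReal (f x))) →
          Integrable (fun ω => KLEntropy.truncatedKL p k δ (fun i => X i ω)) P ∧
          |(∫ ω, KLEntropy.truncatedKL p k δ (fun i => X i ω) ∂P) - KLEntropy.entropy f| ≤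
            C * (Real.log N ^ ((1 + δ) * (1 + 1 / (d : ℝ))) / (N : ℝ) ^ (1 / (d : ℝ))) := by
  obtain ⟨K, hK0, hK⟩ := KLEntropy.exists_ball_error_le p hd Ca Cd Ce
  have hc := KLEntropy.unitBallVolume_pos (d := d) p
  set c := KLEntropy.unitBallVolume d p with hcdef
  set A : ℝ := k * (2 ^ k * Real.exp k) with hAdef
  have hA : 0 < A := by
    have : (0 : ℝ) < k := by exact_mod_cast hk
    positivity
  -- The factor `1/8` is forced by `u₀ M / 2 = C0 c L M / (4 (M+1))` with `M/(M+1) ≥ 1/2`. The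
  -- maximum makes `a ≤ 1` and `Ca c a^d ≤ 1` hold at once.
  obtain ⟨N₁, hN₁⟩ := Filter.eventually_atTop.1
    (KLEntropy.eventually_large_sample δ (C0 * c / 8) A (max 1 (Ca * c)) hδ (by positivity) hA)
  -- The `k + 1` in the threshold sample size ensures that every sample has at least `k` others.
  refine ⟨(|KLEntropy.digamma k| + |Real.log c| + 1) * (1 + 2 * K / (C0 * c)) + 1 / (C0 * c) +
    d * K + 2, max N₁ (k + 1), by positivity, fun f hf hR => ?_⟩
  have := hf.isProbabilityMeasure
  have hfC := hR.bounds_ae hf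
  have hC0a : C0 ≤ Ca := by
    obtain ⟨x, hx⟩ := hfC.exists
    exact hx.1.trans hx.2
  have hCa : 0 < Ca := hC0.trans_le hC0a
  refine ⟨hf.integrable_mul_log hfC hC0, fun N hN Ω _ P _ X hX hind hlaw => ?_⟩
  obtain ⟨M, rfl⟩ := Nat.exists_eq_add_of_le' (show 1 ≤ N by omega)
  have hkM : k ≤ M := by omega
  obtain ⟨hsmall, hlog1, htail⟩ := hN₁ (M + 1) (by omega)
  set L : ℝ := Real.log (M + 1 : ℕ) ^ (1 + δ) with hLdef
  set a := KLEntropy.threshold d (M + 1) δ with hadef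
  have hL : 1 ≤ L := Real.one_le_rpow hlog1 (by linarith)
  have hn0 : (0 : ℝ) < (M + 1 : ℕ) := by positivity
  have had : a ^ d = L / (M + 1 : ℕ) := KLEntropy.threshold_pow hd (by omega)
  have ha : 0 < a := Real.rpow_pos_of_pos (by positivity) _
  have hLn : L / (M + 1 : ℕ) ≤ 1 :=
    le_trans (le_mul_of_one_le_left (by positivity) (le_max_left _ _)) hsmall
  have ha1 : a ≤ 1 := Real.rpow_le_one (by positivity) hLn (by positivity)
  have hCa1 : Ca * c * a ^ d ≤ 1 := by
    rw [had]
    exact le_trans (by gcongr; exact le_max_right _ _) hsmall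
  have hu : C0 * c * a ^ d / 2 ∈ Set.Icc (0 : ℝ) 1 := by
    refine ⟨by positivity, ?_⟩
    have : C0 * c * a ^ d ≤ Ca * c * a ^ d := by gcongr
    linarith
  have hM1 : (1 : ℝ) ≤ M := by exact_mod_cast hk.trans hkM
  have hε : 1 - KLEntropy.binomTail M k (C0 * c * a ^ d / 2) ≤ 1 / ((M + 1 : ℕ) : ℝ) ^ 2 := by
    refine (KLEntropy.one_sub_binomTail_le hkM hu).trans (le_trans ?_ htail)
    rw [← hAdef]
    gcongr
    rw [had, show C0 * c * (L / (M + 1 : ℕ)) / 2 * M / 2 =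
      C0 * c / 8 * L * (2 * (M / (M + 1 : ℕ))) by ring]
    refine le_mul_of_one_le_right (by positivity) ?_
    rw [mul_div_assoc', one_le_div hn0]
    push_cast
    linarith
  obtain ⟨hint, hexp⟩ := KLEntropy.integral_truncatedKL p hd hf hR.bounded hCa.le hk hkM ha ha1
    P X hX hind hlaw
  refine ⟨hint, ?_⟩
  rw [hexp, KLEntropy.rate_eq (by omega), ← hLdef, ← hadef, ← hcdef]
  set B := -KLEntropy.digamma k + Real.log ((M + 1 : ℕ) : ℝ) + Real.log c + d * Real.log a
    with hB
  have hbias := KLEntropy.abs_bias_le p hd hf (B := B) hfC hR.bounded hC0 hCa hK0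
    (hK Cb Cc C0 f hf hR) hk hkM ha ha1 hCa1 hε
  rw [← hcdef] at hbias
  -- With this `B` the centring term of `abs_bias_le` no longer involves `k`, `c` or `a`, and is at
  -- most `1/M` in absolute value.
  have hharm : B - Real.log c - d * Real.log a - (harmonic M - harmonic (k - 1) : ℚ) =
      Real.log ((M + 1 : ℕ) : ℝ) + Real.eulerMascheroniConstant - (harmonic M : ℝ) := by
    rw [hB, KLEntropy.digamma_natCast hk]
    push_cast
    ring
  have hγ := KLEntropy.abs_log_add_eulerMascheroni_sub_harmonic_le (hk.trans hkM)
  rw [← hharm] at hγ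
  refine le_trans ?_ (KLEntropy.bias_terms_le hd (hk.trans hkM) hL ha ha1 had hc hC0 hK0 le_rfl)
  rw [← hB]
  exact (sub_le_iff_le_add'.1 (abs_sub_abs_le_abs_sub _ _)).trans
    ((add_le_add hγ hbias).trans_eq (add_comm _ _))
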